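/- Let $n\ge 1$. Cubes in $\mathbb{R}^n$ have sides parallel to the axes. A weight is a measurable function $w$ on $\mathbb{R}^n$ with $0<w<\infty$ a.e.; write $Mf(x)=\sup_{Q\ni x}\frac1{|Q|}\int_Q|f|\,dy$ and $M_vf(x)=\sup_{Q\ni x}\frac1{v(Q)}\int_Q|f|\,v\,dy$, with suprema over the cubes $Q$ containing $x$ and $v(Q)=\int_Q v\,dx$. A weight $w$ is in $A_1$ if $[w]_{A_1}:=\|Mw/w\|_{L^\infty}<\infty$, and in $A_p$, $1<p<\infty$, if $[w]_{A_p}:=\sup_Q\big(\frac1{|Q|}\int_Q w\big)\big(\frac1{|Q|}\int_Q w^{1-p'}\big)^{p-1}<\infty$, where $p'=\frac{p}{p-1}$. Let $\mathbb{X}$ be a rearrangement invariant Banach function space over $(\mathbb{R}^n,dx)$ (function norm with the lattice property, the Fatou property, $\|\mathbf 1_E\|_{\mathbb X}<\infty$ and $\int_E|f|\,dx\le C_E\|f\|_{\mathbb X}$ for $|E|<\infty$). Let $\overline{\mathbb{X}}$ be its Luxemburg representation, that is, the rearrangement invariant Banach function space over $[0,\infty)$ with $\|f^*\|_{\overline{\mathbb{X}}}=\|f\|_{\mathbb{X}}$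 for all measurable $f$ on $\mathbb{R}^n$. Let $h_{\mathbb{X}}(t)=\sup\{\|g(\cdot/t)\|_{\overline{\mathbb{X}}}:\|g\|_{\overline{\mathbb{X}}}\le1\}$ and let $q_{\mathbb{X}}=\inf_{0<t<1}\frac{\log t}{\log h_{\mathbb{X}}(t)}\in[1,\infty]$ be the upper Boyd index (the quotient being $\infty$ if $h_{\mathbb X}(t)=1$). For a weight $v$, let $\mathbb{X}_v$ be the space with norm $\|f\|_{\mathbb{X}_v}=\|f^*_v\|_{\overline{\mathbb{X}}}$, where $f^*_v(t)=\inf\{\lambda\ge0: v(\{|f|>\lambda\})\le t\}$, and let $\mathbb{X}'_v$ be its associate space over $(\mathbb{R}^n,v\,dx)$, with norm $\|f\|_{\mathbb{X}'_v}=\sup\{\int|fg|\,v\,dx:\|g\|_{\mathbb{X}_v}\le1\}$. **Theorem.** Suppose that $q_{\mathbb{X}}<\infty$. Let $\mathcal{F}$ be a family of pairs $(f,g)$ of measurable functions $f,g:\mathbb{R}^n\to[0,\infty]$, let $p_0\in[1,\infty)$, and let $\Psi:[1,\infty)\to[1,\infty)$ be nondecreasing. Assume that for every $w\in A_{p_0}$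 $$\|f\|_{L^1(w)}\le\Psi([w]_{A_{p_0}})\,\|g\|_{L^1(w)},\qquad (f,g)\in\mathcal{F}.$$ Let $u$ be a weight with $u^{1-p_0'}\in A_1$ if $p_0>1$, and let $u\equiv1$ if $p_0=1$, in which case $[u^{1-p_0'}]_{A_1}^{p_0-1}$ is read as $1$. Let $v\in A_1$ be locally integrable. Then $M_v$ is bounded on $\mathbb{X}'_v$, that is, $\|M_v\|_{\mathbb{X}'_v\to\mathbb{X}'_v}:=\sup\{\|M_vh\|_{\mathbb{X}'_v}:\|h\|_{\mathbb{X}'_v}\le1\}<\infty$, and $$\|fu\|_{\mathbb{X}_v}\le 4\,\Psi\Big(2\,\|M_v\|_{\mathbb{X}'_v\to\mathbb{X}'_v}\,[u^{1-p_0'}]_{A_1}^{p_0-1}\,[v]_{A_1}\Big)\,\|gu\|_{\mathbb{X}_v},\qquad (f,g)\in\mathcal{F}.$$ -/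

import Mathlib

open MeasureTheory
open scoped ENNReal NNReal

noncomputable section

namespace WeightedRI

/-! ### Banach function spaces and rearrangements -/

/-- A Banach function norm over a measure space.  Since the norm of `f` is the norm of `|f|`, it is
recorded on (a.e.-)measurable functions with values in `[0, ∞]`; the Banach function space consists
of those `f` for which the norm of `|f|` is finite.  Only the values of the norm on
`μ`-a.e. measurable functions are meaningful. -/
structure BanachFunctionNorm {α : Type*} [MeasurableSpace α] (μ : Measure α) where
  norm : (α → ℝ≥0∞) → ℝ≥0∞
  norm_eq_zero : ∀ f, AEMeasurable f μ → (norm f = 0 ↔ f =ᵐ[μ] 0)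
  norm_add_le : ∀ f g, AEMeasurable f μ → AEMeasurable g μ → norm (f + g) ≤ norm f + norm g
  norm_smul : ∀ (c : ℝ≥0) f, AEMeasurable f μ → norm (fun x => c * f x) = c * norm f
  norm_mono : ∀ f g, AEMeasurable f μ → AEMeasurable g μ → f ≤ᵐ[μ] g → norm f ≤ norm g
  norm_iSup : ∀ f : ℕ → α → ℝ≥0∞, (∀ j, AEMeasurable (f j) μ) →
    (∀ᵐ x ∂μ, Monotone fun j => f j x) → norm (fun x => ⨆ j, f j x) = ⨆ j, norm (f j)
  norm_indicator_lt_top : ∀ E : Set α, MeasurableSet E → μ E < ∞ →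
    norm (E.indicator fun _ => 1) < ∞
  lintegral_le : ∀ E : Set α, MeasurableSet E → μ E < ∞ →
    ∃ C : ℝ≥0, ∀ f, AEMeasurable f μ → ∫⁻ x in E, f x ∂μ ≤ C * norm f

/-- The distribution function `μ_f(s) = μ {x | f x > s}`. -/
def distribution {α : Type*} [MeasurableSpace α] (μ : Measure α) (f : α → ℝ≥0∞) (s : ℝ≥0∞) :
    ℝ≥0∞ :=
  μ {x | s < f x}

/-- Equimeasurability: `f` and `g` have the same distribution function. -/
def Equimeasurable {α β : Type*} [MeasurableSpace α] [MeasurableSpace β] (μ : Measure α)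
    (ν : Measure β) (f : α → ℝ≥0∞) (g : β → ℝ≥0∞) : Prop :=
  ∀ s : ℝ≥0, distribution μ f s = distribution ν g s

/-- Rearrangement invariance: equimeasurable functions have the same norm. -/
def BanachFunctionNorm.IsRI {α : Type*} [MeasurableSpace α] {μ : Measure α}
    (X : BanachFunctionNorm μ) : Prop :=
  ∀ f g, AEMeasurable f μ → AEMeasurable g μ → Equimeasurable μ μ f g → X.norm f = X.norm g

/-- The decreasing rearrangement `f*(t) = inf {s ≥ 0 | μ_f(s) ≤ t}`, `t ≥ 0`, with respect to `μ`
(equal to `∞` where no finite `s` qualifies). -/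
def decRearr {α : Type*} [MeasurableSpace α] (μ : Measure α) (f : α → ℝ≥0∞) (t : ℝ) : ℝ≥0∞ :=
  sInf {s | distribution μ f s ≤ ENNReal.ofReal t}

/-- Lebesgue measure on `[0, ∞)`. -/
abbrev halfLine : Measure ℝ := volume.restrict (Set.Ici 0)

/-- `x ↦ |{y : ‖y‖ < ‖x‖}| = (2 ‖x‖)ⁿ` for the sup norm of `ℝⁿ`; it carries Lebesgue measure on
`ℝⁿ` to Lebesgue measure on `[0, ∞)`. -/
def radial (n : ℕ) (x : Fin n → ℝ) : ℝ := (2 * ‖x‖) ^ n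

theorem measurePreserving_radial (n : ℕ) [NeZero n] :
    MeasurePreserving (radial n) volume halfLine := by
  have hn : n ≠ 0 := NeZero.ne n
  have hm : Measurable (radial n) := by unfold radial; fun_prop
  have hlt : ∀ b : ℝ, volume {x : Fin n → ℝ | radial n x < b} = ENNReal.ofReal b := by
    intro b
    rcases le_or_gt b 0 with hb | hb
    · have : {x : Fin n → ℝ | radial n x < b} = ∅ := by
        ext x
        simp only [Set.mem_ofPred_eq, Set.mem_empty_iff_false, iff_false, not_lt]
        exact hb.trans (by unfold radial; positivity)
      rw [this, measure_empty, ENNReal.ofReal_of_nonpos hb]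
    · set r : ℝ := b ^ ((n : ℝ)⁻¹) / 2 with hr
      have hr0 : 0 < r := by positivity
      have hrn : (2 * r) ^ n = b := by
        rw [hr, mul_div_cancel₀ _ (two_ne_zero)]
        exact Real.rpow_inv_natCast_pow hb.le hn
      have : {x : Fin n → ℝ | radial n x < b} = Metric.ball 0 r := by
        ext x
        simp only [Set.mem_ofPred_eq, mem_ball_zero_iff, radial]
        rw [← hrn, pow_lt_pow_iff_left₀ (by positivity) (by positivity) hn]
        constructor <;> intro h <;> linarith
      rw [this, Real.volume_pi_ball _ hr0, Fintype.card_fin, hrn]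
  refine ⟨hm, ?_⟩
  have key : ∀ a b : ℝ, a < b →
      (Measure.map (radial n) volume) (Set.Ico a b) = ENNReal.ofReal b - ENNReal.ofReal a := by
    intro a b hab
    rw [Measure.map_apply hm measurableSet_Ico]
    have : radial n ⁻¹' Set.Ico a b = {x | radial n x < b} \ {x | radial n x < a} := by
      ext x; simp [and_comm]
    have hsub : {x | radial n x < a} ⊆ {x | radial n x < b} := fun x hx =>
      lt_trans (show radial n x < a from hx) hab
    rw [this, measure_sdiff hsub (measurableSet_lt hm measurable_const).nullMeasurableSet
      (by rw [hlt]; exact ENNReal.ofReal_ne_top), hlt, hlt]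
  refine Measure.ext_of_Ico' _ _ (fun a b hab => ?_) (fun a b hab => ?_)
  · rw [key a b hab]; exact ENNReal.sub_ne_top ENNReal.ofReal_ne_top
  · rw [key a b hab, Measure.restrict_apply measurableSet_Ico]
    have : Set.Ico a b ∩ Set.Ici 0 = Set.Ico (max a 0) b := by
      ext x; simp only [Set.mem_inter_iff, Set.mem_Ico, Set.mem_Ici, max_le_iff]; tauto
    rw [this, Real.volume_Ico, ENNReal.ofReal_sub _ (le_max_right _ _)]
    rcases le_total a 0 with h | h
    · rw [max_eq_right h, ENNReal.ofReal_of_nonpos h, ENNReal.ofReal_zero]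
    · rw [max_eq_left h]

/-- The representation space `X̄` over `[0, ∞)` of a Banach function space `X` over `ℝⁿ`:
`‖g‖_X̄` is the norm in `X` of the radial copy `x ↦ g ((2 ‖x‖)ⁿ)` of `g`.
If `X` is rearrangement invariant, `X̄` is the rearrangement invariant space over `[0, ∞)` with
`‖f*‖_X̄ = ‖f‖_X`, and the only one: see `isRI_rep`, `norm_rep_decRearr`, `norm_rep_unique`. -/
def BanachFunctionNorm.rep {n : ℕ} [NeZero n]
    (X : BanachFunctionNorm (volume : Measure (Fin n → ℝ))) : BanachFunctionNorm halfLine where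
  norm g := X.norm fun x => g (radial n x)
  norm_eq_zero f hf := by
    have hp := measurePreserving_radial n
    refine (X.norm_eq_zero _ (hf.comp_quasiMeasurePreserving hp.quasiMeasurePreserving)).trans ?_
    constructor
    · intro h
      have h1 : volume (radial n ⁻¹' {t | f t ≠ 0}) = 0 := h
      exact (hp.measure_preimage
        (hf.nullMeasurable (measurableSet_singleton (0 : ℝ≥0∞)).compl)).symm.trans h1
    · intro h
      exact hp.quasiMeasurePreserving.ae_eq_comp h
  norm_add_le f g hf hg :=
    X.norm_add_le _ _
      (hf.comp_quasiMeasurePreserving (measurePreserving_radial n).quasiMeasurePreserving)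
      (hg.comp_quasiMeasurePreserving (measurePreserving_radial n).quasiMeasurePreserving)
  norm_smul c f hf :=
    X.norm_smul c _
      (hf.comp_quasiMeasurePreserving (measurePreserving_radial n).quasiMeasurePreserving)
  norm_mono f g hf hg h :=
    X.norm_mono _ _
      (hf.comp_quasiMeasurePreserving (measurePreserving_radial n).quasiMeasurePreserving)
      (hg.comp_quasiMeasurePreserving (measurePreserving_radial n).quasiMeasurePreserving)
      ((measurePreserving_radial n).quasiMeasurePreserving.ae h)
  norm_iSup f hf h :=
    X.norm_iSup _
      (fun j => (hf j).comp_quasiMeasurePreserving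
        (measurePreserving_radial n).quasiMeasurePreserving)
      ((measurePreserving_radial n).quasiMeasurePreserving.ae h)
  norm_indicator_lt_top E hE h := by
    have hp := measurePreserving_radial n
    exact X.norm_indicator_lt_top (radial n ⁻¹' E) (hp.measurable hE)
      (by rwa [hp.measure_preimage hE.nullMeasurableSet])
  lintegral_le E hE h := by
    have hp := measurePreserving_radial n
    obtain ⟨C, hC⟩ := X.lintegral_le (radial n ⁻¹' E) (hp.measurable hE)
      (by rwa [hp.measure_preimage hE.nullMeasurableSet])
    refine ⟨C, fun f hf => ?_⟩
    refine le_trans (le_of_eq ?_)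
      (hC _ (hf.comp_quasiMeasurePreserving hp.quasiMeasurePreserving))
    have hp' := hp.restrict_preimage hE
    have hf' : AEMeasurable f (Measure.map (radial n) (volume.restrict (radial n ⁻¹' E))) := by
      rw [hp'.map_eq]; exact hf.restrict
    calc ∫⁻ x in E, f x ∂halfLine
        = ∫⁻ x, f x ∂(Measure.map (radial n) (volume.restrict (radial n ⁻¹' E))) := by
          rw [hp'.map_eq]
      _ = _ := lintegral_map' hf' hp.measurable.aemeasurable

theorem aemeasurable_decRearr {α : Type*} [MeasurableSpace α] (μ : Measure α) (f : α → ℝ≥0∞)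
    (ν : Measure ℝ) : AEMeasurable (decRearr μ f) ν := by
  have : Antitone (decRearr μ f) := fun a b hab =>
    sInf_le_sInf fun s hs => le_trans hs (ENNReal.ofReal_le_ofReal hab)
  exact this.measurable.aemeasurable

theorem lt_decRearr_iff {α : Type*} [MeasurableSpace α] (μ : Measure α) (f : α → ℝ≥0∞)
    (s : ℝ≥0) (t : ℝ) :
    s < decRearr μ f t ↔ ENNReal.ofReal t < distribution μ f s := by
  have hanti : ∀ a b : ℝ≥0∞, a ≤ b → distribution μ f b ≤ distribution μ f a :=
    fun a b hab => measure_mono fun x hx => lt_of_le_of_lt hab hx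
  constructor
  · intro h
    by_contra! hc
    exact absurd (sInf_le (show (s : ℝ≥0∞) ∈ {s | distribution μ f s ≤ ENNReal.ofReal t} from hc))
      (not_le.2 h)
  · intro h
    obtain ⟨u, hu, hus, hut⟩ := exists_seq_strictAnti_tendsto' (ENNReal.coe_lt_top (r := s))
    have hU : {x | (s : ℝ≥0∞) < f x} = ⋃ k, {x | u k < f x} := by
      ext x
      simp only [Set.mem_ofPred_eq, Set.mem_iUnion]
      constructor
      · intro hx
        exact ((hut.eventually (gt_mem_nhds hx))).exists
      · rintro ⟨k, hk⟩
        exact (hus k).1.trans hk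
    have hmono : Monotone fun k => {x | u k < f x} := fun a b hab x hx =>
      lt_of_le_of_lt (hu.antitone hab) hx
    have : ENNReal.ofReal t < ⨆ k, distribution μ f (u k) := by
      unfold distribution at h ⊢
      rwa [hU, hmono.measure_iUnion] at h
    obtain ⟨k, hk⟩ := lt_iSup_iff.1 this
    refine lt_of_lt_of_le (hus k).1 (le_sInf fun r hr => ?_)
    by_contra! hc
    exact absurd (le_trans (hanti _ _ hc.le) hr) (not_le.2 hk)

theorem equimeasurable_decRearr {α : Type*} [MeasurableSpace α] (μ : Measure α) (f : α → ℝ≥0∞) :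
    Equimeasurable halfLine μ (decRearr μ f) f := by
  intro s
  have h1 : distribution halfLine (decRearr μ f) s
      = halfLine {t : ℝ | ENNReal.ofReal t < distribution μ f s} := by
    unfold distribution
    congr 1
    ext t
    exact lt_decRearr_iff μ f s t
  rw [h1]
  generalize distribution μ f s = a
  have hm : MeasurableSet {t : ℝ | ENNReal.ofReal t < a} :=
    measurableSet_lt ENNReal.measurable_ofReal measurable_const
  rw [Measure.restrict_apply hm]
  induction a using ENNReal.recTopCoe with
  | top => simp
  | coe a =>
    have : {t : ℝ | ENNReal.ofReal t < (a : ℝ≥0∞)} ∩ Set.Ici 0 = Set.Ico 0 (a : ℝ) := by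
      ext t
      simp only [Set.mem_inter_iff, Set.mem_ofPred_eq, Set.mem_Ici, Set.mem_Ico]
      constructor
      · rintro ⟨h, h0⟩
        refine ⟨h0, ?_⟩
        rw [← ENNReal.ofReal_coe_nnreal] at h
        exact (ENNReal.ofReal_lt_ofReal_iff_of_nonneg h0).1 h
      · rintro ⟨h0, h⟩
        refine ⟨?_, h0⟩
        rw [← ENNReal.ofReal_coe_nnreal]
        exact (ENNReal.ofReal_lt_ofReal_iff_of_nonneg h0).2 h
    rw [this, Real.volume_Ico, sub_zero, ENNReal.ofReal_coe_nnreal]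

theorem equimeasurable_radial {n : ℕ} [NeZero n] {g : ℝ → ℝ≥0∞} (hg : AEMeasurable g halfLine) :
    Equimeasurable volume halfLine (fun x : Fin n → ℝ => g (radial n x)) g := fun s =>
  (measurePreserving_radial n).measure_preimage
    (hg.nullMeasurable (measurableSet_Ioi (a := (s : ℝ≥0∞))))

theorem isRI_rep {n : ℕ} [NeZero n] {X : BanachFunctionNorm (volume : Measure (Fin n → ℝ))}
    (hX : X.IsRI) : X.rep.IsRI := fun _ _ hf hg h =>
  hX _ _
    (hf.comp_quasiMeasurePreserving (measurePreserving_radial n).quasiMeasurePreserving)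
    (hg.comp_quasiMeasurePreserving (measurePreserving_radial n).quasiMeasurePreserving)
    fun s => (equimeasurable_radial hf s).trans ((h s).trans (equimeasurable_radial hg s).symm)

/-- The Luxemburg representation `‖f*‖_X̄ = ‖f‖_X`. -/
theorem norm_rep_decRearr {n : ℕ} [NeZero n]
    {X : BanachFunctionNorm (volume : Measure (Fin n → ℝ))} (hX : X.IsRI) {f : (Fin n → ℝ) → ℝ≥0∞}
    (hf : AEMeasurable f volume) : X.rep.norm (decRearr volume f) = X.norm f :=
  hX _ _
    ((aemeasurable_decRearr volume f halfLine).comp_quasiMeasurePreserving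
      (measurePreserving_radial n).quasiMeasurePreserving) hf
    fun s => (equimeasurable_radial (aemeasurable_decRearr volume f halfLine) s).trans
      (equimeasurable_decRearr volume f s)

/-- The representation space is determined by the Luxemburg representation. -/
theorem norm_rep_unique {n : ℕ} [NeZero n]
    {X : BanachFunctionNorm (volume : Measure (Fin n → ℝ))}
    {Y : BanachFunctionNorm halfLine} (hY : Y.IsRI)
    (h : ∀ f, AEMeasurable f volume → Y.norm (decRearr volume f) = X.norm f)
    {g : ℝ → ℝ≥0∞} (hg : AEMeasurable g halfLine) : Y.norm g = X.rep.norm g := by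
  have hg' : AEMeasurable (fun x : Fin n → ℝ => g (radial n x)) volume :=
    hg.comp_quasiMeasurePreserving (measurePreserving_radial n).quasiMeasurePreserving
  refine Eq.trans (hY _ _ hg (aemeasurable_decRearr _ _ _) fun s => ?_) (h _ hg')
  exact (equimeasurable_radial hg s).symm.trans (equimeasurable_decRearr _ _ s).symm

/-! ### Boyd index, weighted spaces, associate spaces -/

/-- `h_X(t)`, the norm on `X̄` of the dilation `D_t g (s) = g (s / t)`. -/
def dilationNorm {n : ℕ} [NeZero n] (X : BanachFunctionNorm (volume : Measure (Fin n → ℝ)))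
    (t : ℝ) : ℝ≥0∞ :=
  ⨆ (g : ℝ → ℝ≥0∞) (_ : AEMeasurable g halfLine) (_ : X.rep.norm g ≤ 1),
    X.rep.norm fun s => g (s / t)

/-- The upper Boyd index `q_X = inf_{0 < t < 1} log t / log h_X(t)`, in `[0, ∞]`.  Both logarithms
are nonpositive, so the quotient is taken of their negatives; it is `∞` where `h_X(t) = 1`. -/
def upperBoydIndex {n : ℕ} [NeZero n] (X : BanachFunctionNorm (volume : Measure (Fin n → ℝ))) :
    ℝ≥0∞ :=
  ⨅ (t : ℝ) (_ : 0 < t) (_ : t < 1),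
    ENNReal.ofReal (-Real.log t) / ENNReal.ofReal (-Real.log (dilationNorm X t).toReal)

/-- The norm of the weighted space `X_v = X(v)`: `‖f‖_{X_v} = ‖f*_v‖_X̄`, where `f*_v` is the
decreasing rearrangement of `f` with respect to `v dx`. -/
def weightedNorm {n : ℕ} [NeZero n] (X : BanachFunctionNorm (volume : Measure (Fin n → ℝ)))
    (v f : (Fin n → ℝ) → ℝ≥0∞) : ℝ≥0∞ :=
  X.rep.norm (decRearr (volume.withDensity v) f)

/-- The associate norm `‖f‖' = sup {∫ f g dμ | ‖g‖ ≤ 1}` of a norm `ρ` over `μ`. -/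
def associateNorm {α : Type*} [MeasurableSpace α] (μ : Measure α)
    (ρ : (α → ℝ≥0∞) → ℝ≥0∞) (f : α → ℝ≥0∞) : ℝ≥0∞ :=
  ⨆ (g : α → ℝ≥0∞) (_ : AEMeasurable g μ) (_ : ρ g ≤ 1), ∫⁻ x, f x * g x ∂μ

/-- The norm of `X'_v`, the associate space of `X_v` over `(ℝⁿ, v dx)`. -/
def weightedAssociateNorm {n : ℕ} [NeZero n]
    (X : BanachFunctionNorm (volume : Measure (Fin n → ℝ))) (v : (Fin n → ℝ) → ℝ≥0∞) :
    ((Fin n → ℝ) → ℝ≥0∞) → ℝ≥0∞ :=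
  associateNorm (volume.withDensity v) (weightedNorm X v)

/-! ### Maximal operators and Muckenhoupt weights -/

/-- The uncentered maximal operator over cubes with sides parallel to the axes (these are the balls
of the sup norm on `Fin n → ℝ`), with averages taken with respect to the measure `μ`. -/
def maximal {n : ℕ} (μ : Measure (Fin n → ℝ)) (f : (Fin n → ℝ) → ℝ≥0∞) (x : Fin n → ℝ) : ℝ≥0∞ :=
  ⨆ (c : Fin n → ℝ) (r : ℝ) (_ : 0 < r) (_ : x ∈ Metric.ball c r),
    ⨍⁻ y in Metric.ball c r, f y ∂μ

/-- The operator norm on `X'_v` of the weighted maximal operator `M_v`. -/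
def maximalOpNorm {n : ℕ} [NeZero n] (X : BanachFunctionNorm (volume : Measure (Fin n → ℝ)))
    (v : (Fin n → ℝ) → ℝ≥0∞) : ℝ≥0∞ :=
  ⨆ (h : (Fin n → ℝ) → ℝ≥0∞) (_ : AEMeasurable h volume) (_ : weightedAssociateNorm X v h ≤ 1),
    weightedAssociateNorm X v (maximal (volume.withDensity v) h)

/-- A weight: a measurable function with `0 < w < ∞` almost everywhere. -/
def IsWeight {n : ℕ} (w : (Fin n → ℝ) → ℝ≥0∞) : Prop :=
  AEMeasurable w volume ∧ ∀ᵐ x, 0 < w x ∧ w x < ∞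

/-- `[w]_{A_p}` for `1 ≤ p < ∞`; note `1 - p' = 1 - p / (p - 1)`. -/
def ApConst {n : ℕ} (p : ℝ) (w : (Fin n → ℝ) → ℝ≥0∞) : ℝ≥0∞ :=
  open Classical in
  if p = 1 then essSup (fun x => maximal volume w x / w x) volume
  else ⨆ (c : Fin n → ℝ) (r : ℝ) (_ : 0 < r),
    (⨍⁻ y in Metric.ball c r, w y ∂volume) *
      (⨍⁻ y in Metric.ball c r, w y ^ (1 - p.conjExponent) ∂volume) ^ (p - 1)

/-- The Muckenhoupt class `A_p`, `1 ≤ p < ∞`. -/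
def MemAp {n : ℕ} (p : ℝ) (w : (Fin n → ℝ) → ℝ≥0∞) : Prop :=
  IsWeight w ∧ ApConst p w < ∞

end WeightedRI

end

open WeightedRI

namespace WeightedRI

/-! ### Decreasing rearrangements -/

section Rearrangement

variable {α : Type*} [MeasurableSpace α] {μ : Measure α}

/-! Write μ = v dx, M for the maximal operator of μ, A for its norm on X'_v, and f* for the
rearrangement with respect to μ.

Boundedness of M on X'_v. Since v is a locally integrable A₁ weight, μ is doubling, so M has weak
type (1,1) by Vitali covering (`mul_measure_lt_maximal_le`). Splitting f at the height f*(t) gives t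
(Mf)*(t) ≤ C ∫_{f > f*(t)} f dμ (`decRearr_maximal_mul_le`). Together with the Hardy–Littlewood
rearrangement inequality and Tonelli, this yields ∫ Mf · g dμ ≤ C ∫ f S dμ, where S(x) is the
integral of g*(t)/t over {t > 0 : f*(t) < f(x)}. Whatever f is, S*(a) is at most the integral of
g*(t)/t over t > a, hence at most a multiple of ∑ₖ g*(a bᵏ). Finiteness of q_X makes one dilation a
strict contraction of X̄, so for a suitable b this sum is a convergent Neumann series of dilations,
and ‖S‖ ≤ K‖g‖ in X_v. Hölder's inequality for X_v and X'_v finishes. The bound at f*(t) needs f to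
have null level sets; a function comparable to f has them (`exists_comparable_null_level_sets`).

Extrapolation. By Lorentz–Luxemburg duality (`weightedNorm_le_of_forall_lintegral_le`) it suffices
to bound ∫ f u h dμ for ‖h‖ ≤ 1 in X'_v. The Rubio de Francia series H = ∑ₖ (2A)⁻ᵏ Mᵏh satisfies h ≤
H, ‖H‖ ≤ 2 and MH ≤ 2A H. The last property puts H v in A₁ with constant at most 2A[v]. Since u is
the power 1 - p₀ of an A₁ weight when p₀ > 1, H v u lies in A_{p₀} with the constant that appears
inside Ψ. The hypothesis for the weight H v u, followed by Hölder's inequality, gives the estimate.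
-/

theorem decRearr_anti (μ : Measure α) (f : α → ℝ≥0∞) : Antitone (decRearr μ f) := fun _ _ hab =>
  sInf_le_sInf fun _ hs => le_trans hs (ENNReal.ofReal_le_ofReal hab)

theorem measurable_decRearr (μ : Measure α) (f : α → ℝ≥0∞) : Measurable (decRearr μ f) :=
  (decRearr_anti μ f).measurable

theorem decRearr_le_of_distribution_le {f : α → ℝ≥0∞} {s : ℝ≥0∞} {t : ℝ}
    (h : μ {x | s < f x} ≤ ENNReal.ofReal t) : decRearr μ f t ≤ s :=
  sInf_le h

/-- Distribution functions are right continuous, so the infimum defining the rearrangement is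
attained; `lt_decRearr_iff` encodes this. -/
theorem distribution_decRearr_le (f : α → ℝ≥0∞) (t : ℝ) :
    μ {x | decRearr μ f t < f x} ≤ ENNReal.ofReal t := by
  rcases eq_or_ne (decRearr μ f t) ∞ with h | h
  · simp [h]
  · lift decRearr μ f t to ℝ≥0 using h with s hs
    by_contra! hc
    exact absurd ((lt_decRearr_iff μ f s t).2 hc) (by rw [← hs]; exact lt_irrefl _)

theorem decRearr_mono_ae {f g : α → ℝ≥0∞} (h : f ≤ᵐ[μ] g) (t : ℝ) :
    decRearr μ f t ≤ decRearr μ g t :=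
  sInf_le_sInf fun s hs => le_trans (measure_mono_ae (by
    filter_upwards [h] with x hx hs using lt_of_lt_of_le hs hx)) hs

theorem decRearr_congr_ae {f g : α → ℝ≥0∞} (h : f =ᵐ[μ] g) : decRearr μ f = decRearr μ g :=
  funext fun t => le_antisymm (decRearr_mono_ae h.le t) (decRearr_mono_ae h.symm.le t)

theorem eq_of_forall_coe_lt_iff {a b : ℝ≥0∞} (h : ∀ s : ℝ≥0, s < a ↔ s < b) : a = b := by
  refine le_antisymm (le_of_forall_lt fun c hc => ?_) (le_of_forall_lt fun c hc => ?_)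
  · lift c to ℝ≥0 using hc.ne_top
    exact (h c).1 hc
  · lift c to ℝ≥0 using hc.ne_top
    exact (h c).2 hc

theorem decRearr_smul {c : ℝ≥0} (hc : c ≠ 0) (f : α → ℝ≥0∞) (t : ℝ) :
    decRearr μ (fun x => c * f x) t = c * decRearr μ f t := by
  have hc' : (c : ℝ≥0∞) ≠ 0 := by simpa using hc
  have key : ∀ (s : ℝ≥0) (a : ℝ≥0∞), (s : ℝ≥0∞) < c * a ↔ ((s / c : ℝ≥0) : ℝ≥0∞) < a := by
    intro s a
    rw [ENNReal.coe_div hc, ENNReal.div_lt_iff (Or.inl hc') (Or.inl ENNReal.coe_ne_top), mul_comm]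
  refine eq_of_forall_coe_lt_iff fun s => ?_
  rw [lt_decRearr_iff, key, lt_decRearr_iff]
  simp only [distribution, key]

theorem decRearr_iSup {f : ℕ → α → ℝ≥0∞} (hf : Monotone f) (t : ℝ) :
    decRearr μ (fun x => ⨆ j, f j x) t = ⨆ j, decRearr μ (f j) t := by
  refine eq_of_forall_coe_lt_iff fun s => ?_
  have h1 : {x | (s : ℝ≥0∞) < ⨆ j, f j x} = ⋃ j, {x | (s : ℝ≥0∞) < f j x} := by
    ext x; simp [lt_iSup_iff]
  have h2 : Monotone fun j => {x | (s : ℝ≥0∞) < f j x} := fun a b hab x hx =>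
    lt_of_lt_of_le hx (hf hab x)
  rw [lt_decRearr_iff, distribution, h1, h2.measure_iUnion, lt_iSup_iff, lt_iSup_iff]
  simp only [lt_decRearr_iff, distribution]

theorem halfLine_ofReal_lt (a : ℝ≥0∞) : halfLine {t : ℝ | ENNReal.ofReal t < a} = a := by
  have hm : MeasurableSet {t : ℝ | ENNReal.ofReal t < a} :=
    measurableSet_lt ENNReal.measurable_ofReal measurable_const
  rw [Measure.restrict_apply hm]
  induction a using ENNReal.recTopCoe with
  | top => simp
  | coe a =>
    have : {t : ℝ | ENNReal.ofReal t < (a : ℝ≥0∞)} ∩ Set.Ici 0 = Set.Ico 0 (a : ℝ) := by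
      ext t
      simp only [Set.mem_inter_iff, Set.mem_ofPred_eq, Set.mem_Ici, Set.mem_Ico]
      rw [and_comm]
      refine and_congr_right fun h0 => ?_
      rw [← ENNReal.ofReal_coe_nnreal, ENNReal.ofReal_lt_ofReal_iff_of_nonneg h0]
    rw [this, Real.volume_Ico, sub_zero, ENNReal.ofReal_coe_nnreal]

/-- Layer cake representation of the integral of a product. -/
theorem lintegral_mul_eq_lintegral_measure_inter {ν : Measure α} [SFinite ν] {F G : α → ℝ≥0∞}
    (hF : Measurable F) (hG : Measurable G) :
    ∫⁻ x, F x * G x ∂ν = ∫⁻ p : ℝ × ℝ,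
      ν ({x | ENNReal.ofReal p.1 < F x} ∩ {x | ENNReal.ofReal p.2 < G x})
        ∂(halfLine.prod halfLine) := by
  let W : Set (α × (ℝ × ℝ)) :=
    {q | ENNReal.ofReal q.2.1 < F q.1} ∩ {q | ENNReal.ofReal q.2.2 < G q.1}
  have hW : MeasurableSet W := by
    refine (measurableSet_lt ?_ ?_).inter (measurableSet_lt ?_ ?_) <;> fun_prop
  -- The product is the area of the rectangle [0, F x) × [0, G x); Tonelli then exchanges area and
  -- ν.
  have h1 : ∀ x, F x * G x = (halfLine.prod halfLine) (Prod.mk x ⁻¹' W) := by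
    intro x
    have : Prod.mk x ⁻¹' W = {t : ℝ | ENNReal.ofReal t < F x} ×ˢ {t : ℝ | ENNReal.ofReal t < G x} :=
      rfl
    rw [this, Measure.prod_prod, halfLine_ofReal_lt, halfLine_ofReal_lt]
  calc ∫⁻ x, F x * G x ∂ν = ∫⁻ x, (halfLine.prod halfLine) (Prod.mk x ⁻¹' W) ∂ν := by simp only [h1]
    _ = (ν.prod (halfLine.prod halfLine)) W := (Measure.prod_apply hW).symm
    _ = ∫⁻ p, ν ((fun x => (x, p)) ⁻¹' W) ∂(halfLine.prod halfLine) := Measure.prod_apply_symm hW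
    _ = _ := rfl

/-- The Hardy–Littlewood rearrangement inequality. -/
theorem lintegral_mul_le_lintegral_decRearr_mul [SFinite μ] {F G : α → ℝ≥0∞}
    (hF : AEMeasurable F μ) (hG : AEMeasurable G μ) :
    ∫⁻ x, F x * G x ∂μ ≤ ∫⁻ t, decRearr μ F t * decRearr μ G t ∂halfLine := by
  have hlhs : ∫⁻ x, F x * G x ∂μ = ∫⁻ x, hF.mk F x * hG.mk G x ∂μ :=
    lintegral_congr_ae (by filter_upwards [hF.ae_eq_mk, hG.ae_eq_mk] with x h1 h2; rw [h1, h2])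
  rw [hlhs, decRearr_congr_ae hF.ae_eq_mk, decRearr_congr_ae hG.ae_eq_mk,
    lintegral_mul_eq_lintegral_measure_inter hF.measurable_mk hG.measurable_mk,
    lintegral_mul_eq_lintegral_measure_inter (measurable_decRearr _ _) (measurable_decRearr _ _)]
  refine lintegral_mono fun p => ?_
  -- Superlevel sets of decreasing rearrangements are nested, so their intersection has the smaller
  -- of the two measures, the largest value possible for the original sets.
  have : {t | ENNReal.ofReal p.1 < decRearr μ (hF.mk F) t} ∩
      {t | ENNReal.ofReal p.2 < decRearr μ (hG.mk G) t} =
      {t : ℝ | ENNReal.ofReal t < min (distribution μ (hF.mk F) (ENNReal.ofReal p.1))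
        (distribution μ (hG.mk G) (ENNReal.ofReal p.2))} := by
    ext t
    simp only [Set.mem_inter_iff, Set.mem_ofPred_eq, lt_min_iff, ENNReal.ofReal, lt_decRearr_iff]
  rw [this, halfLine_ofReal_lt]
  exact le_min (measure_mono Set.inter_subset_left) (measure_mono Set.inter_subset_right)

end Rearrangement

/-! ### The norm of `X_v` -/

section WeightedNorm

variable {n : ℕ} [NeZero n] {X : BanachFunctionNorm (volume : Measure (Fin n → ℝ))}
  {v : (Fin n → ℝ) → ℝ≥0∞}

theorem weightedNorm_mono {f g : (Fin n → ℝ) → ℝ≥0∞} (h : f ≤ᵐ[volume.withDensity v] g) :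
    weightedNorm X v f ≤ weightedNorm X v g :=
  X.rep.norm_mono _ _ (aemeasurable_decRearr _ _ _) (aemeasurable_decRearr _ _ _)
    (Filter.Eventually.of_forall fun t => decRearr_mono_ae h t)

theorem weightedNorm_smul {c : ℝ≥0} (hc : c ≠ 0) (f : (Fin n → ℝ) → ℝ≥0∞) :
    weightedNorm X v (fun x => c * f x) = c * weightedNorm X v f := by
  unfold weightedNorm
  rw [← X.rep.norm_smul c _ (aemeasurable_decRearr _ _ _)]
  congr 1
  exact funext fun t => decRearr_smul hc f t

theorem weightedNorm_iSup {f : ℕ → (Fin n → ℝ) → ℝ≥0∞} (hf : Monotone f) :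
    weightedNorm X v (fun x => ⨆ j, f j x) = ⨆ j, weightedNorm X v (f j) := by
  unfold weightedNorm
  rw [← X.rep.norm_iSup _ (fun j => aemeasurable_decRearr _ _ _)]
  · congr 1
    exact funext fun t => decRearr_iSup hf t
  · exact Filter.Eventually.of_forall fun t i j hij =>
      decRearr_mono_ae (Filter.Eventually.of_forall fun x => hf hij x) t

theorem weightedNorm_eq_zero {f : (Fin n → ℝ) → ℝ≥0∞} (h : weightedNorm X v f = 0) :
    f =ᵐ[volume.withDensity v] 0 := by
  have h0 := (X.rep.norm_eq_zero _ (aemeasurable_decRearr _ _ _)).1 h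
  have h1 := equimeasurable_decRearr (volume.withDensity v) f 0
  have h2 : distribution halfLine (decRearr (volume.withDensity v) f) ((0 : ℝ≥0) : ℝ≥0∞) = 0 := by
    refine measure_mono_null (fun t ht => ?_) (ae_iff.1 h0)
    intro h
    have ht' : ((0 : ℝ≥0) : ℝ≥0∞) < decRearr (volume.withDensity v) f t := ht
    rw [h] at ht'
    exact absurd ht' (by simp)
  rw [h2] at h1
  refine ae_iff.2 (measure_mono_null (fun x hx => ?_) h1.symm)
  exact lt_of_le_of_ne (by simp) (Ne.symm hx)

theorem weightedNorm_indicator_lt_top {E : Set (Fin n → ℝ)}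
    (h : volume.withDensity v E < ∞) : weightedNorm X v (E.indicator fun _ => 1) < ∞ := by
  set m := volume.withDensity v E with hm
  have hle : ∀ᵐ t ∂halfLine, decRearr (volume.withDensity v) (E.indicator fun _ => 1) t ≤
      (Set.Ico 0 m.toReal).indicator (fun _ => 1) t := by
    filter_upwards [ae_restrict_mem measurableSet_Ici] with t ht
    by_cases htm : t < m.toReal
    · rw [Set.indicator_of_mem (show t ∈ Set.Ico 0 m.toReal from ⟨ht, htm⟩)]
      refine decRearr_le_of_distribution_le (le_of_eq_of_le ?_ zero_le)
      convert measure_empty (μ := volume.withDensity v)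
      ext x
      simp only [Set.mem_ofPred_eq, Set.mem_empty_iff_false, iff_false, not_lt]
      exact Set.indicator_le_self' (by simp) x
    · refine le_trans (decRearr_le_of_distribution_le (s := 0) ?_) zero_le
      refine le_trans (measure_mono fun x hx => ?_) (show m ≤ _ from ?_)
      · by_contra hxE
        simp [Set.indicator_of_notMem hxE] at hx
      · exact ENNReal.le_ofReal_iff_toReal_le h.ne ht |>.2 (not_lt.1 htm)
  refine lt_of_le_of_lt (X.rep.norm_mono _ _ (aemeasurable_decRearr _ _ _)
    (measurable_const.indicator measurableSet_Ico).aemeasurable hle)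
    (X.rep.norm_indicator_lt_top _ measurableSet_Ico ?_)
  exact lt_of_le_of_lt (Measure.restrict_apply_le _ _) (by simp)

end WeightedNorm

/-! ### The maximal operator -/

section Maximal

variable {n : ℕ} {μ : Measure (Fin n → ℝ)}

theorem lt_maximal_iff {f : (Fin n → ℝ) → ℝ≥0∞} {x : Fin n → ℝ} {s : ℝ≥0∞} :
    s < maximal μ f x ↔ ∃ (c : Fin n → ℝ) (r : ℝ), 0 < r ∧ x ∈ Metric.ball c r ∧
      s < ⨍⁻ y in Metric.ball c r, f y ∂μ := by
  simp only [maximal, lt_iSup_iff, exists_prop]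

theorem laverage_le_maximal (f : (Fin n → ℝ) → ℝ≥0∞) {x c : Fin n → ℝ} {r : ℝ} (hr : 0 < r)
    (hx : x ∈ Metric.ball c r) : ⨍⁻ y in Metric.ball c r, f y ∂μ ≤ maximal μ f x := by
  unfold maximal
  exact le_iSup_of_le c (le_iSup_of_le r (le_iSup_of_le hr (le_iSup_of_le hx le_rfl)))

theorem maximal_le {f : (Fin n → ℝ) → ℝ≥0∞} {x : Fin n → ℝ} {s : ℝ≥0∞}
    (h : ∀ (c : Fin n → ℝ) (r : ℝ), 0 < r → x ∈ Metric.ball c r →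
      ⨍⁻ y in Metric.ball c r, f y ∂μ ≤ s) : maximal μ f x ≤ s :=
  iSup_le fun c => iSup_le fun r => iSup_le fun hr => iSup_le fun hx => h c r hr hx

/-- A cube witnessing the inequality at x witnesses it at each of its points. Hence `maximal μ f` is
measurable for every f. -/
theorem isOpen_lt_maximal (μ : Measure (Fin n → ℝ)) (f : (Fin n → ℝ) → ℝ≥0∞) (s : ℝ≥0∞) :
    IsOpen {x | s < maximal μ f x} := by
  refine isOpen_iff_forall_mem_open.2 fun x hx => ?_
  obtain ⟨c, r, hr, hxc, hs⟩ := lt_maximal_iff.1 hx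
  exact ⟨Metric.ball c r, fun y hy => lt_of_lt_of_le hs (laverage_le_maximal f hr hy),
    Metric.isOpen_ball, hxc⟩

theorem measurable_maximal (μ : Measure (Fin n → ℝ)) (f : (Fin n → ℝ) → ℝ≥0∞) :
    Measurable (maximal μ f) :=
  measurable_of_Ioi fun s => (isOpen_lt_maximal μ f s).measurableSet

theorem maximal_mono_ae {f g : (Fin n → ℝ) → ℝ≥0∞} (h : f ≤ᵐ[μ] g) (x : Fin n → ℝ) :
    maximal μ f x ≤ maximal μ g x :=
  maximal_le fun c r hr hx => le_trans
    (by rw [setLAverage_eq, setLAverage_eq]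
        gcongr ?_ / _
        exact lintegral_mono_ae (ae_restrict_of_ae h))
    (laverage_le_maximal g hr hx)

theorem maximal_congr_ae {f g : (Fin n → ℝ) → ℝ≥0∞} (h : f =ᵐ[μ] g) :
    maximal μ f = maximal μ g :=
  funext fun x => le_antisymm (maximal_mono_ae h.le x) (maximal_mono_ae h.symm.le x)

theorem maximal_const_mul_le {f : (Fin n → ℝ) → ℝ≥0∞} {a : ℝ≥0∞} (ha : a ≠ ∞)
    (x : Fin n → ℝ) : maximal μ (fun y => a * f y) x ≤ a * maximal μ f x :=
  maximal_le fun c r hr hx => by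
    rw [setLAverage_eq, lintegral_const_mul' _ _ ha, mul_div_assoc, ← setLAverage_eq]
    gcongr
    exact laverage_le_maximal f hr hx

theorem maximal_const_mul {f : (Fin n → ℝ) → ℝ≥0∞} {a : ℝ≥0∞} (ha0 : a ≠ 0) (ha : a ≠ ∞)
    (x : Fin n → ℝ) : maximal μ (fun y => a * f y) x = a * maximal μ f x := by
  refine le_antisymm (maximal_const_mul_le ha x) ?_
  have h := maximal_const_mul_le (μ := μ) (f := fun y => a * f y) (ENNReal.inv_ne_top.2 ha0) x
  simp only [← mul_assoc, ENNReal.inv_mul_cancel ha0 ha, one_mul] at h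
  calc a * maximal μ f x ≤ a * (a⁻¹ * maximal μ (fun y => a * f y) x) := by gcongr
    _ = _ := by rw [← mul_assoc, ENNReal.mul_inv_cancel ha0 ha, one_mul]

theorem maximal_tsum_le {f : ℕ → (Fin n → ℝ) → ℝ≥0∞} (hf : ∀ k, AEMeasurable (f k) μ)
    (x : Fin n → ℝ) : maximal μ (fun y => ∑' k, f k y) x ≤ ∑' k, maximal μ (f k) x :=
  maximal_le fun c r hr hx => by
    rw [setLAverage_eq, lintegral_tsum (fun k => (hf k).restrict), div_eq_mul_inv,
      ← ENNReal.tsum_mul_right]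
    refine ENNReal.tsum_le_tsum fun k => ?_
    rw [← div_eq_mul_inv, ← setLAverage_eq]
    exact laverage_le_maximal _ hr hx

theorem maximal_iSup {f : ℕ → (Fin n → ℝ) → ℝ≥0∞} (hf : ∀ k, AEMeasurable (f k) μ)
    (hm : Monotone f) (x : Fin n → ℝ) :
    maximal μ (fun y => ⨆ k, f k y) x = ⨆ k, maximal μ (f k) x := by
  refine le_antisymm (maximal_le fun c r hr hx => ?_) (iSup_le fun k =>
    maximal_mono_ae (Filter.Eventually.of_forall fun y => le_iSup (fun k => f k y) k) x)
  rw [setLAverage_eq, lintegral_iSup' (fun k => (hf k).restrict)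
    (Filter.Eventually.of_forall fun y i j hij => hm hij y), div_eq_mul_inv, ENNReal.iSup_mul]
  refine iSup_mono fun k => ?_
  rw [← div_eq_mul_inv, ← setLAverage_eq]
  exact laverage_le_maximal _ hr hx

/-- `μ` gives all cubes positive finite measure and is doubling with constant `D`. -/
structure DoublingOnCubes (μ : Measure (Fin n → ℝ)) (D : ℝ≥0) : Prop where
  pos : ∀ (c : Fin n → ℝ) (r : ℝ), 0 < r → 0 < μ (Metric.ball c r)
  lt_top : ∀ (c : Fin n → ℝ) (r : ℝ), μ (Metric.ball c r) < ∞
  doubling : ∀ (c : Fin n → ℝ) (r : ℝ), 0 < r →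
    μ (Metric.ball c (6 * r)) ≤ D * μ (Metric.ball c r)

variable {D : ℝ≥0}

theorem maximal_le_add_const (hμ : DoublingOnCubes μ D) {f g : (Fin n → ℝ) → ℝ≥0∞} {a : ℝ≥0∞}
    (h : ∀ y, f y ≤ g y + a) (x : Fin n → ℝ) : maximal μ f x ≤ maximal μ g x + a :=
  maximal_le fun c r hr hx => by
    have h1 : ∫⁻ y in Metric.ball c r, f y ∂μ ≤
        ∫⁻ y in Metric.ball c r, g y ∂μ + a * μ (Metric.ball c r) := by
      refine (lintegral_mono h).trans ?_
      rw [lintegral_add_right _ measurable_const, setLIntegral_const]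
    rw [setLAverage_eq]
    refine (ENNReal.div_le_div_right h1 _).trans ?_
    rw [ENNReal.add_div, ENNReal.mul_div_cancel_right (hμ.pos c r hr).ne' (hμ.lt_top c r).ne,
      ← setLAverage_eq]
    gcongr
    exact laverage_le_maximal g hr hx

/-- If the maximal function vanished at one point x, f would have integral zero over all cubes
centred at x, and these exhaust the space. -/
theorem maximal_pos (hμ : DoublingOnCubes μ D) {f : (Fin n → ℝ) → ℝ≥0∞} (hf : AEMeasurable f μ)
    (h : ¬ f =ᵐ[μ] 0) (x : Fin n → ℝ) : 0 < maximal μ f x := by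
  by_contra! h0
  have hball : ∀ k : ℕ, ∫⁻ y in Metric.ball x (k + 1), f y ∂μ = 0 := by
    intro k
    have h1 := (laverage_le_maximal (μ := μ) f (by positivity)
      (Metric.mem_ball_self (by positivity : (0 : ℝ) < k + 1))).trans h0
    rw [setLAverage_eq, nonpos_iff_eq_zero, ENNReal.div_eq_zero_iff] at h1
    exact h1.resolve_right (hμ.lt_top _ _).ne
  have hU : ⋃ k : ℕ, Metric.ball x ((k : ℝ) + 1) = Set.univ := by
    exact Metric.iUnion_ball_nat_succ x
  have h2 : ∀ᵐ y ∂μ.restrict (⋃ k : ℕ, Metric.ball x ((k : ℝ) + 1)), f y = 0 :=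
    (ae_restrict_iUnion_iff _ _).2 fun k => (lintegral_eq_zero_iff' hf.restrict).1 (hball k)
  rw [hU, Measure.restrict_univ] at h2
  exact h h2

/-- The weak type `(1, 1)` inequality for the maximal operator of a doubling measure. -/
theorem mul_measure_lt_maximal_le (hμ : DoublingOnCubes μ D) (f : (Fin n → ℝ) → ℝ≥0∞) (s : ℝ≥0∞) :
    s * μ {x | s < maximal μ f x} ≤ D * ∫⁻ y, f y ∂μ := by
  let I := {p : (Fin n → ℝ) × ℝ // 0 < p.2 ∧ s < ⨍⁻ y in Metric.ball p.1 p.2, f y ∂μ}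
  have hU : {x | s < maximal μ f x} = ⋃ i : I, Metric.ball i.1.1 i.1.2 := by
    ext x
    simp only [Set.mem_ofPred_eq, lt_maximal_iff, Set.mem_iUnion, I, Subtype.exists, Prod.exists]
    constructor
    · rintro ⟨c, r, hr, hx, h⟩; exact ⟨c, r, ⟨hr, h⟩, hx⟩
    · rintro ⟨c, r, ⟨hr, h⟩, hx⟩; exact ⟨c, r, hr, hx, h⟩
  have hfin : ∀ t : Finset I, s * μ (⋃ i ∈ t, Metric.ball i.1.1 i.1.2) ≤ D * ∫⁻ y, f y ∂μ := by
    intro t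
    obtain ⟨R, hR⟩ : ∃ R, ∀ i ∈ t, i.1.2 ≤ R := by
      obtain ⟨R, hR⟩ := (t.image fun i : I => i.1.2).bddAbove
      exact ⟨R, fun i hi => hR (Finset.mem_coe.2 (Finset.mem_image_of_mem _ hi))⟩
    -- Vitali enlarges closed balls by 5; enlarging to 6 returns to open balls, whence the 6 in
    -- `DoublingOnCubes`. Finiteness of t bounds the radii.
    obtain ⟨w, hwt, hdisj, hcov⟩ := Vitali.exists_disjoint_subfamily_covering_enlargement_closedBall
      (t : Set I) (fun i => i.1.1) (fun i => i.1.2) R hR 5 (by norm_num)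
    have hwc : w.Countable := t.countable_toSet.mono hwt
    have hsub : (⋃ i ∈ t, Metric.ball i.1.1 i.1.2) ⊆ ⋃ i ∈ w, Metric.ball i.1.1 (6 * i.1.2) := by
      intro x hx
      simp only [Set.mem_iUnion, exists_prop] at hx ⊢
      obtain ⟨i, hi, hxi⟩ := hx
      obtain ⟨j, hj, hij⟩ := hcov i hi
      refine ⟨j, hj, Metric.closedBall_subset_ball ?_ (hij (Metric.ball_subset_closedBall hxi))⟩
      linarith [j.2.1]
    have hdisj' : w.PairwiseDisjoint fun i => Metric.ball i.1.1 i.1.2 :=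
      fun i hi j hj hij => (hdisj hi hj hij).mono Metric.ball_subset_closedBall
        Metric.ball_subset_closedBall
    calc s * μ (⋃ i ∈ t, Metric.ball i.1.1 i.1.2)
        ≤ s * ∑' i : w, μ (Metric.ball i.1.1.1 (6 * i.1.1.2)) := by
          gcongr
          exact (measure_mono hsub).trans (measure_biUnion_le _ hwc _)
      _ ≤ ∑' i : w, D * ∫⁻ y in Metric.ball i.1.1.1 i.1.1.2, f y ∂μ := by
          rw [← ENNReal.tsum_mul_left]
          refine ENNReal.tsum_le_tsum fun i => ?_
          have h1 := i.1.2.2.le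
          rw [setLAverage_eq, ENNReal.le_div_iff_mul_le (Or.inl (hμ.pos _ _ i.1.2.1).ne')
            (Or.inl (hμ.lt_top _ _).ne)] at h1
          calc s * μ (Metric.ball i.1.1.1 (6 * i.1.1.2))
              ≤ s * (D * μ (Metric.ball i.1.1.1 i.1.1.2)) := by
                gcongr; exact hμ.doubling _ _ i.1.2.1
            _ = D * (s * μ (Metric.ball i.1.1.1 i.1.1.2)) := by ring
            _ ≤ _ := by gcongr
      _ = D * ∫⁻ y in ⋃ i ∈ w, Metric.ball i.1.1 i.1.2, f y ∂μ := by
          rw [ENNReal.tsum_mul_left, lintegral_biUnion hwc (fun i _ => measurableSet_ball) hdisj']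
      _ ≤ _ := by gcongr; exact Measure.restrict_le_self
  -- Lindelöf reduces the superlevel set to countably many cubes, which increasing finite unions
  -- exhaust.
  obtain ⟨T, hTc, hT⟩ := TopologicalSpace.isOpen_iUnion_countable
    (fun i : I => Metric.ball i.1.1 i.1.2) fun i => Metric.isOpen_ball
  rw [hU, ← hT]
  have : Countable T := hTc
  have hfs : (⋃ i ∈ T, Metric.ball i.1.1 i.1.2) =
      ⋃ t : Finset T, ⋃ i ∈ t.map (Function.Embedding.subtype _), Metric.ball i.1.1 i.1.2 := by
    ext x
    simp only [Set.mem_iUnion, exists_prop, Finset.mem_map, Function.Embedding.subtype_apply]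
    constructor
    · rintro ⟨i, hi, hx⟩
      exact ⟨{⟨i, hi⟩}, i, ⟨⟨i, hi⟩, by simp⟩, hx⟩
    · rintro ⟨t, i, ⟨j, -, rfl⟩, hx⟩
      exact ⟨j, j.2, hx⟩
  rw [hfs, Directed.measure_iUnion, ENNReal.mul_iSup]
  · exact iSup_le fun t => hfin _
  · refine Monotone.directed_le fun a b hab => ?_
    exact Set.biUnion_subset_biUnion_left fun i hi => Finset.map_subset_map.2 hab hi

end Maximal

/-! ### `A₁` weights -/

section AOne

variable {n : ℕ} {w : (Fin n → ℝ) → ℝ≥0∞}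

theorem volume_ball_pos (c : Fin n → ℝ) {r : ℝ} (hr : 0 < r) :
    0 < volume (Metric.ball c r) := Metric.measure_ball_pos volume c hr

theorem volume_ball_six_mul (c : Fin n → ℝ) {r : ℝ} (hr : 0 < r) :
    volume (Metric.ball c (6 * r)) = 6 ^ n * volume (Metric.ball c r) := by
  rw [Real.volume_pi_ball _ hr, Real.volume_pi_ball _ (by positivity), Fintype.card_fin,
    show 2 * (6 * r) = 6 * (2 * r) by ring, mul_pow, ENNReal.ofReal_mul (by positivity),
    ENNReal.ofReal_pow (by norm_num)]
  norm_num

theorem apConst_one (w : (Fin n → ℝ) → ℝ≥0∞) :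
    ApConst 1 w = essSup (fun x => maximal volume w x / w x) volume := if_pos rfl

theorem MemAp.ae_maximal_le (hw : MemAp 1 w) :
    ∀ᵐ x, maximal volume w x ≤ ApConst 1 w * w x := by
  rw [apConst_one]
  filter_upwards [ENNReal.ae_le_essSup fun x => maximal volume w x / w x, hw.1.2] with x hx h0
  rwa [ENNReal.div_le_iff h0.1.ne' h0.2.ne] at hx

theorem MemAp.ae_laverage_le (hw : MemAp 1 w) : ∀ᵐ x, ∀ (c : Fin n → ℝ) (r : ℝ), 0 < r →
    x ∈ Metric.ball c r → ⨍⁻ y in Metric.ball c r, w y ∂volume ≤ ApConst 1 w * w x := by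
  filter_upwards [hw.ae_maximal_le] with x hx c r hr hxc
  exact (laverage_le_maximal w hr hxc).trans hx

theorem apConst_one_le {C : ℝ≥0∞} (h : ∀ᵐ x, maximal volume w x ≤ C * w x) :
    ApConst 1 w ≤ C := by
  rw [apConst_one]
  refine essSup_le_of_ae_le _ ?_
  filter_upwards [h] with x hx using ENNReal.div_le_of_le_mul hx

theorem IsWeight.laverage_pos (hw : IsWeight w) (c : Fin n → ℝ) {r : ℝ} (hr : 0 < r) :
    0 < ⨍⁻ y in Metric.ball c r, w y ∂volume := by
  rw [setLAverage_eq]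
  refine ENNReal.div_pos (fun h => ?_) measure_ball_lt_top.ne
  have h1 := (lintegral_eq_zero_iff' hw.1.restrict).1 h
  have h2 : ∀ᵐ x ∂(volume.restrict (Metric.ball c r)), False := by
    filter_upwards [h1, ae_restrict_of_ae hw.2] with x hx h0
    exact h0.1.ne' hx
  have h3 : volume (Metric.ball c r) = 0 := by simpa using h2
  exact (volume_ball_pos c hr).ne' h3

/-- The average of v over the cube of radius 6r is at most [v] v(x) for almost every x in the
concentric cube of radius r. Integrating over the small cube compares the two v-masses, with a
factor 6ⁿ from their volumes. -/
theorem exists_doublingOnCubes {v : (Fin n → ℝ) → ℝ≥0∞} (hv : MemAp 1 v)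
    (hvloc : ∀ K : Set (Fin n → ℝ), IsCompact K → ∫⁻ x in K, v x < ∞) :
    ∃ D, DoublingOnCubes (volume.withDensity v) D := by
  have hball : ∀ (c : Fin n → ℝ) r, volume.withDensity v (Metric.ball c r) =
      ∫⁻ y in Metric.ball c r, v y := fun c r => withDensity_apply _ measurableSet_ball
  refine ⟨6 ^ n * (ApConst 1 v).toNNReal, ⟨fun c r hr => ?_, fun c r => ?_, fun c r hr => ?_⟩⟩
  · have := hv.1.laverage_pos c hr
    rw [setLAverage_eq] at this
    rw [hball]
    exact pos_of_ne_zero fun h => by simp [h] at this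
  · rw [hball]
    exact lt_of_le_of_lt (lintegral_mono' (Measure.restrict_mono Metric.ball_subset_closedBall
      le_rfl) le_rfl) (hvloc _ (isCompact_closedBall c r))
  · have h6 : (0 : ℝ) < 6 * r := by positivity
    set a := ⨍⁻ y in Metric.ball c (6 * r), v y ∂volume with ha
    have h1 : a * volume (Metric.ball c r) ≤ ApConst 1 v * ∫⁻ y in Metric.ball c r, v y := by
      rw [← setLIntegral_const, ← lintegral_const_mul' _ _ hv.2.ne]
      refine lintegral_mono_ae ?_
      filter_upwards [ae_restrict_of_ae hv.ae_laverage_le, ae_restrict_mem measurableSet_ball]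
        with x hx hxc
      exact hx _ _ h6 (Metric.ball_subset_ball (by linarith) hxc)
    calc volume.withDensity v (Metric.ball c (6 * r)) = a * volume (Metric.ball c (6 * r)) := by
          rw [hball, ha, setLAverage_eq, ENNReal.div_mul_cancel (volume_ball_pos c h6).ne'
            measure_ball_lt_top.ne]
      _ = 6 ^ n * (a * volume (Metric.ball c r)) := by rw [volume_ball_six_mul c hr]; ring
      _ ≤ 6 ^ n * (ApConst 1 v * ∫⁻ y in Metric.ball c r, v y) := by gcongr
      _ = _ := by rw [hball]; push_cast; rw [ENNReal.coe_toNNReal hv.2.ne]; ring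

end AOne

/-! ### Removing level sets of positive measure -/

/-- Round f down to a power of 2 and multiply by the factor 1 + 1/(1 + ‖x‖) in (1, 2], which is
strictly decreasing in ‖x‖. A nonzero level set of the result is covered by countably many spheres,
which are null. -/
theorem exists_comparable_null_level_sets {n : ℕ} [NeZero n] {f : (Fin n → ℝ) → ℝ≥0∞}
    (hf : Measurable f) (hfin : ∀ x, f x ≠ ∞) :
    ∃ g : (Fin n → ℝ) → ℝ≥0∞, Measurable g ∧ (∀ x, f x ≤ 2 * g x) ∧ (∀ x, g x ≤ 2 * f x) ∧
      ∀ s ≠ 0, volume {x | g x = s} = 0 := by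
  classical
  let d : ℝ≥0∞ → ℝ≥0∞ := fun s => ⨆ k : ℤ, (Set.Ici ((2 : ℝ≥0∞) ^ k)).indicator
    (fun _ => (2 : ℝ≥0∞) ^ k) s
  have hd : Measurable d := .iSup fun k => measurable_const.indicator measurableSet_Ici
  have hd0 : d 0 = 0 := by
    simp only [d, ENNReal.iSup_eq_zero]
    intro k
    refine Set.indicator_of_notMem (fun h => ?_) _
    exact (ENNReal.zpow_pos two_ne_zero ENNReal.ofNat_ne_top k).not_ge h
  have hdk : ∀ s, s ≠ 0 → s ≠ ∞ → ∃ k : ℤ, d s = 2 ^ k ∧ d s ≤ s ∧ s ≤ 2 * d s := by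
    intro s h0 h1
    obtain ⟨k, hk1, hk2⟩ := ENNReal.exists_mem_Ico_zpow h0 h1 ENNReal.one_lt_two
      ENNReal.ofNat_ne_top
    have hds : d s = 2 ^ k := by
      refine le_antisymm (iSup_le fun j => ?_) (le_iSup_of_le k ?_)
      · by_cases hj : (2 : ℝ≥0∞) ^ j ≤ s
        · rw [Set.indicator_of_mem (show s ∈ Set.Ici _ from hj)]
          refine ENNReal.zpow_le_of_le one_le_two ?_
          by_contra! hkj
          exact absurd ((ENNReal.zpow_le_of_le one_le_two (show k + 1 ≤ j by omega)).trans hj)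
            (not_le.2 hk2)
        · rw [Set.indicator_of_notMem (show s ∉ Set.Ici _ from hj)]
          exact zero_le
      · rw [Set.indicator_of_mem (show s ∈ Set.Ici _ from hk1)]
    refine ⟨k, hds, hds ▸ hk1, ?_⟩
    rw [hds]
    refine hk2.le.trans (le_of_eq ?_)
    rw [ENNReal.zpow_add two_ne_zero ENNReal.ofNat_ne_top, zpow_one, mul_comm]
  have hcomp : ∀ s, s ≠ ∞ → d s ≤ s ∧ s ≤ 2 * d s := by
    intro s hs
    rcases eq_or_ne s 0 with rfl | h0
    · simp [hd0]
    · obtain ⟨k, -, h⟩ := hdk s h0 hs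
      exact h
  let θ : (Fin n → ℝ) → ℝ≥0∞ := fun x => 1 + (1 + ‖x‖ₑ)⁻¹
  have hθ1 : ∀ x, 1 ≤ θ x := fun x => le_self_add
  have hθ2 : ∀ x, θ x ≤ 2 := fun x => by
    rw [← one_add_one_eq_two]
    simp only [θ]
    gcongr
    exact ENNReal.inv_le_one.2 le_self_add
  refine ⟨fun x => d (f x) * θ x, ?_, fun x => ?_, fun x => ?_, fun s hs => ?_⟩
  · exact (hd.comp hf).mul (by simp only [θ]; fun_prop)
  · refine (hcomp _ (hfin x)).2.trans ?_
    gcongr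
    exact le_mul_of_one_le_right zero_le (hθ1 x)
  · exact (mul_le_mul' (hcomp _ (hfin x)).1 (hθ2 x)).trans (mul_comm _ _).le
  · have hsub : {x | d (f x) * θ x = s} ⊆ ⋃ k : ℤ, {x | 2 ^ k * θ x = s} := by
      intro x hx
      have hx' : d (f x) * θ x = s := hx
      have h0 : f x ≠ 0 := fun h => hs (by rw [← hx', h, hd0, zero_mul])
      obtain ⟨k, hk, -⟩ := hdk _ h0 (hfin x)
      exact Set.mem_iUnion.2 ⟨k, by rw [← hk]; exact hx'⟩
    refine measure_mono_null hsub (measure_iUnion_null fun k => ?_)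
    rcases Set.eq_empty_or_nonempty {x : Fin n → ℝ | 2 ^ k * θ x = s} with h | ⟨x₀, hx₀⟩
    · rw [h, measure_empty]
    · have : Nonempty (Fin n) := ⟨0⟩
      refine measure_mono_null (fun x hx => ?_) (Measure.addHaar_sphere volume 0 ‖x₀‖)
      have h1 : (2 : ℝ≥0∞) ^ k * θ x = 2 ^ k * θ x₀ :=
        (show _ = s from hx).trans (show _ = s from hx₀).symm
      have h2 := (ENNReal.mul_right_inj (ENNReal.zpow_pos two_ne_zero ENNReal.ofNat_ne_top k).ne'
        (ENNReal.zpow_ne_top two_ne_zero ENNReal.ofNat_ne_top k)).1 h1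
      have h3 := inv_injective ((ENNReal.add_right_inj ENNReal.one_ne_top).1 h2)
      have h4 := (ENNReal.add_right_inj ENNReal.one_ne_top).1 h3
      rw [mem_sphere_zero_iff_norm]
      simpa only [toReal_enorm] using congrArg ENNReal.toReal h4

/-! ### Rearrangement of the maximal function -/

section

variable {n : ℕ} {μ : Measure (Fin n → ℝ)} {D : ℝ≥0} {f : (Fin n → ℝ) → ℝ≥0∞}

/-- Each level below f*(t) is exceeded on a set of measure greater than t, so {f ≥ f*(t)} has
measure at least t by continuity from above; this is where finite support enters. Null level sets
make the inequality strict, and Chebyshev's inequality concludes. -/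
theorem decRearr_mul_le_setLIntegral {α : Type*} [MeasurableSpace α] {μ : Measure α}
    {f : α → ℝ≥0∞} (hf : Measurable f) (hsupp : μ {x | 0 < f x} < ∞)
    (hlev : ∀ s ≠ 0, μ {x | f x = s} = 0) (t : ℝ) :
    decRearr μ f t * ENNReal.ofReal t ≤ ∫⁻ x in {x | decRearr μ f t < f x}, f x ∂μ := by
  set l := decRearr μ f t with hl
  rcases eq_or_ne l 0 with h0 | h0
  · simp [h0]
  obtain ⟨u, hu, hul, hut⟩ := exists_seq_strictMono_tendsto' (pos_of_ne_zero h0)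
  have hI : {x | l ≤ f x} = ⋂ k, {x | u k < f x} := by
    ext x
    simp only [Set.mem_ofPred_eq, Set.mem_iInter]
    exact ⟨fun h k => (hul k).2.trans_le h, fun h => le_of_tendsto' hut fun k => (h k).le⟩
  have hge : ENNReal.ofReal t ≤ μ {x | l ≤ f x} := by
    rw [hI, Antitone.measure_iInter]
    · refine le_iInf fun k => ?_
      have hk := (hul k).2
      lift u k to ℝ≥0 using hk.ne_top with uk
      exact ((lt_decRearr_iff μ f uk t).1 hk).le
    · exact fun i j hij x hx => lt_of_le_of_lt (hu.monotone hij) hx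
    · exact fun k => (measurableSet_lt measurable_const hf).nullMeasurableSet
    · exact ⟨0, ne_top_of_le_ne_top hsupp.ne
        (measure_mono fun x (hx : u 0 < f x) => lt_of_le_of_lt zero_le hx)⟩
  have hsub : {x | l ≤ f x} ⊆ {x | l < f x} ∪ {x | f x = l} := fun x hx =>
    (lt_or_eq_of_le (show l ≤ f x from hx)).imp id Eq.symm
  have hge' : ENNReal.ofReal t ≤ μ {x | l < f x} := by
    refine hge.trans ((measure_mono hsub).trans ((measure_union_le _ _).trans ?_))
    rw [hlev l h0, add_zero]
  calc l * ENNReal.ofReal t ≤ l * μ {x | l < f x} := by gcongr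
    _ = ∫⁻ _ in {x | l < f x}, l ∂μ := (setLIntegral_const _ _).symm
    _ ≤ _ := setLIntegral_mono hf fun x hx => (show l < f x from hx).le

/-- A form of the estimate (Mf)*(t) ≤ (C/t) ∫₀ᵗ f*. The part of f above f*(t) is handled by the weak
type inequality; the remaining part is bounded by f*(t), which the preceding lemma compares with
I/t. -/
theorem decRearr_maximal_mul_le (hμ : DoublingOnCubes μ D) (hf : Measurable f)
    (hsupp : μ {x | 0 < f x} < ∞) (hint : ∫⁻ x, f x ∂μ ≠ ∞)
    (hlev : ∀ s ≠ 0, μ {x | f x = s} = 0) {t : ℝ} (ht : 0 < t) :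
    decRearr μ (maximal μ f) t * ENNReal.ofReal t ≤
      (D + 2) * ∫⁻ x in {x | decRearr μ f t < f x}, f x ∂μ := by
  have ht0 : ENNReal.ofReal t ≠ 0 := by simpa using ht
  have hlt := decRearr_mul_le_setLIntegral hf hsupp hlev t
  set l := decRearr μ f t with hl
  set A := {x | l < f x} with hA
  have hAm : MeasurableSet A := measurableSet_lt measurable_const hf
  set I := ∫⁻ x in A, f x ∂μ with hI
  have hIA : ∫⁻ x, A.indicator f x ∂μ = I := lintegral_indicator hAm _
  have hItop : I ≠ ∞ := ne_top_of_le_ne_top hint (lintegral_mono' Measure.restrict_le_self le_rfl)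
  have hmax : ∀ x, maximal μ f x ≤ maximal μ (A.indicator f) x + l := by
    refine maximal_le_add_const hμ fun y => ?_
    by_cases hy : y ∈ A
    · rw [Set.indicator_of_mem hy]; exact le_self_add
    · rw [Set.indicator_of_notMem hy, zero_add]; exact not_lt.1 hy
  have hlI : l ≤ I / ENNReal.ofReal t :=
    (ENNReal.le_div_iff_mul_le (Or.inl ht0) (Or.inl ENNReal.ofReal_ne_top)).2 hlt
  rcases eq_or_ne I 0 with hI0 | hI0
  · have hl0 : l = 0 := by simpa [hI0] using hlI
    have h0 : A.indicator f =ᵐ[μ] 0 :=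
      (lintegral_eq_zero_iff (hf.indicator hAm)).1 (hIA.trans hI0)
    have hM : ∀ x, maximal μ f x = 0 := fun x => by
      refine nonpos_iff_eq_zero.1 ((hmax x).trans ?_)
      rw [hl0, add_zero, maximal_congr_ae h0]
      exact maximal_le fun c r _ _ => by simp
    have : decRearr μ (maximal μ f) t ≤ 0 := decRearr_le_of_distribution_le (by simp [hM])
    rw [nonpos_iff_eq_zero.1 this, zero_mul]
    exact zero_le
  -- At this height the weak type bound D I/s is at most t. Taking D + 1 in place of D keeps s
  -- nonzero even if D = 0; adding l ≤ I/t produces D + 2.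
  · set s := (D + 1) * I / ENNReal.ofReal t with hs
    have hD : ((D : ℝ≥0∞) + 1) ≠ ∞ := by simp
    have hs0 : s ≠ 0 := (ENNReal.div_pos (mul_ne_zero (by simp) hI0) ENNReal.ofReal_ne_top).ne'
    have hsfin : s ≠ ∞ := ENNReal.div_ne_top (ENNReal.mul_ne_top hD hItop) ht0
    have hst : s * ENNReal.ofReal t = (D + 1) * I :=
      ENNReal.div_mul_cancel ht0 ENNReal.ofReal_ne_top
    have hweak := mul_measure_lt_maximal_le hμ (A.indicator f) s
    rw [hIA] at hweak
    have hmeas : μ {x | s < maximal μ (A.indicator f) x} ≤ ENNReal.ofReal t := by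
      refine (ENNReal.mul_le_mul_iff_right hs0 hsfin).1 (hweak.trans ?_)
      rw [hst]
      gcongr
      exact le_self_add
    have hdec : decRearr μ (maximal μ f) t ≤ s + I / ENNReal.ofReal t := by
      refine decRearr_le_of_distribution_le (le_trans (measure_mono fun x hx => ?_) hmeas)
      by_contra! hc
      have hx' : s + I / ENNReal.ofReal t < maximal μ f x := hx
      exact absurd ((hmax x).trans (add_le_add (not_lt.1 hc) hlI)) (not_le.2 hx')
    calc _ ≤ (s + I / ENNReal.ofReal t) * ENNReal.ofReal t := by gcongr
      _ = (D + 1) * I + I := by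
        rw [add_mul, hst, ENNReal.div_mul_cancel ht0 ENNReal.ofReal_ne_top]
      _ = _ := by ring

end

/-! ### Boundedness of the maximal operator on the associate space -/

section BanachFunctionNorm

variable {α : Type*} [MeasurableSpace α] {μ : Measure α}

theorem BanachFunctionNorm.norm_tsum_le (Y : BanachFunctionNorm μ) {F : ℕ → α → ℝ≥0∞}
    (hF : ∀ k, AEMeasurable (F k) μ) :
    Y.norm (fun x => ∑' k, F k x) ≤ ∑' k, Y.norm (F k) := by
  have h0 : Y.norm 0 = 0 := (Y.norm_eq_zero 0 aemeasurable_const).2 Filter.EventuallyEq.rfl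
  have hfin : ∀ N, Y.norm (fun x => ∑ k ∈ Finset.range N, F k x) ≤
      ∑ k ∈ Finset.range N, Y.norm (F k) := by
    intro N
    induction N with
    | zero => simpa using (show Y.norm (fun _ => 0) = 0 from h0).le
    | succ N ih =>
      simp only [Finset.sum_range_succ]
      exact (Y.norm_add_le _ _ (Finset.aemeasurable_fun_sum _ fun k _ => hF k) (hF N)).trans
        (by gcongr)
  simp only [ENNReal.tsum_eq_iSup_nat]
  rw [Y.norm_iSup]
  · exact iSup_mono hfin
  · exact fun N => Finset.aemeasurable_fun_sum _ fun k _ => hF k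
  · refine Filter.Eventually.of_forall fun x a b hab => ?_
    exact Finset.sum_le_sum_of_subset (Finset.range_mono hab)

/-- A homogeneity principle: a bound on the unit ball of one homogeneous functional by another. -/
theorem le_mul_of_forall_smul_le {a b C : ℝ≥0∞} (hC : C ≠ ∞) (ha : a ≠ ∞)
    (h : ∀ c : ℝ≥0, c ≠ 0 → c * a ≤ 1 → c * b ≤ C) : b ≤ C * a := by
  rcases eq_or_ne a 0 with rfl | ha0
  · rw [mul_zero, nonpos_iff_eq_zero]
    by_contra hb
    obtain ⟨k, hk⟩ := ENNReal.exists_nat_mul_gt hb hC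
    rcases Nat.eq_zero_or_pos k with rfl | hk0
    · simp at hk
    · exact absurd (h k (by exact_mod_cast hk0.ne') (by simp)) (not_le.2 (by simpa using hk))
  · lift a to ℝ≥0 using ha
    have ha0' : a ≠ 0 := by simpa using ha0
    have := h a⁻¹ (inv_ne_zero ha0') (by
      rw [ENNReal.coe_inv ha0', ENNReal.inv_mul_cancel ha0 ENNReal.coe_ne_top])
    rw [ENNReal.coe_inv ha0'] at this
    calc b = a * ((a : ℝ≥0∞)⁻¹ * b) := by
          rw [← mul_assoc, ENNReal.mul_inv_cancel ha0 ENNReal.coe_ne_top, one_mul]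
      _ ≤ a * C := by gcongr
      _ = _ := mul_comm _ _

end BanachFunctionNorm

/-! ### Dilations and the upper Boyd index -/

section Boyd

variable {n : ℕ} [NeZero n] {X : BanachFunctionNorm (volume : Measure (Fin n → ℝ))}

/-- If the upper Boyd index is finite, some dilation is a strict contraction. -/
theorem exists_dilation_contraction (hq : upperBoydIndex X < ∞) :
    ∃ t : ℝ, 0 < t ∧ t < 1 ∧ ∃ η : ℝ≥0, η < 1 ∧ ∀ G : ℝ → ℝ≥0∞, Measurable G →
      X.rep.norm G ≠ ∞ → X.rep.norm (fun s => G (s / t)) ≤ η * X.rep.norm G := by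
  simp only [upperBoydIndex, iInf_lt_iff] at hq
  obtain ⟨t, ht0, ht1, h⟩ := hq
  set d := dilationNorm X t with hd
  -- A nonnegative logarithm makes the truncated denominator 0 and the quotient ∞. This also
  -- excludes d = ∞, where `toReal` gives 0 and `Real.log 0 = 0`.
  have hlog : Real.log d.toReal < 0 := by
    by_contra! hc
    have hnum : 0 < ENNReal.ofReal (-Real.log t) := by
      simpa using Real.log_neg ht0 ht1
    rw [ENNReal.ofReal_of_nonpos (by linarith : -Real.log d.toReal ≤ 0),
      ENNReal.div_zero hnum.ne'] at h
    exact lt_irrefl _ h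
  have hdtop : d ≠ ∞ := fun hc => by simp [hc] at hlog
  have hd1 : d.toReal < 1 := by
    by_contra! hc
    exact absurd (Real.log_nonneg hc) (not_le.2 hlog)
  refine ⟨t, ht0, ht1, d.toNNReal, ?_, fun G hG hGtop => ?_⟩
  · exact_mod_cast (show ((d.toNNReal : ℝ≥0) : ℝ) < 1 from hd1)
  · rw [ENNReal.coe_toNNReal hdtop]
    have hsm : Measurable fun s : ℝ => G (s / t) := by fun_prop
    refine le_mul_of_forall_smul_le hdtop hGtop fun c _ hc => ?_
    rw [← X.rep.norm_smul c _ hsm.aemeasurable]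
    rw [← X.rep.norm_smul c _ hG.aemeasurable] at hc
    exact le_iSup₂_of_le (f := fun (g : ℝ → ℝ≥0∞) (_ : AEMeasurable g halfLine) =>
      ⨆ (_ : X.rep.norm g ≤ 1), X.rep.norm fun s => g (s / t)) (fun s => c * G s)
      (hG.const_mul _).aemeasurable (le_iSup_of_le hc le_rfl)

/-- With b = 1/t, the k-th dilate is the k-th iterate of a contraction of norm η, so the series is
dominated by a geometric one and K = 1/(1 - η). -/
theorem exists_norm_tsum_dilation_le (hq : upperBoydIndex X < ∞) :
    ∃ b : ℝ, 1 < b ∧ ∃ K : ℝ≥0, ∀ G : ℝ → ℝ≥0∞, Measurable G →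
      X.rep.norm G ≠ ∞ → X.rep.norm (fun s => ∑' k : ℕ, G (s * b ^ k)) ≤ K * X.rep.norm G := by
  obtain ⟨t, ht0, ht1, η, hη, h⟩ := exists_dilation_contraction hq
  have hηtop : (1 - (η : ℝ≥0∞))⁻¹ ≠ ∞ := by
    rw [ENNReal.inv_ne_top]
    exact (tsub_pos_of_lt (by exact_mod_cast hη)).ne'
  refine ⟨t⁻¹, (one_lt_inv₀ ht0).2 ht1, ((1 - (η : ℝ≥0∞))⁻¹).toNNReal, fun G hG hGtop => ?_⟩
  have hk : ∀ k : ℕ, X.rep.norm (fun s => G (s * t⁻¹ ^ k)) ≤ η ^ k * X.rep.norm G := by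
    intro k
    induction k with
    | zero => simp
    | succ k ih =>
      have hm : Measurable fun s : ℝ => G (s * t⁻¹ ^ k) := by fun_prop
      have := h _ hm (ne_top_of_le_ne_top (ENNReal.mul_ne_top (by simp) hGtop) ih)
      calc X.rep.norm (fun s => G (s * t⁻¹ ^ (k + 1)))
          = X.rep.norm (fun s => G (s / t * t⁻¹ ^ k)) := by
            congr 1; ext s; congr 1; rw [pow_succ']; ring
        _ ≤ η * (η ^ k * X.rep.norm G) := this.trans (by gcongr)
        _ = _ := by ring
  refine (X.rep.norm_tsum_le fun k => ?_).trans ?_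
  · have hm : Measurable fun s : ℝ => G (s * t⁻¹ ^ k) := by fun_prop
    exact hm.aemeasurable
  · rw [ENNReal.coe_toNNReal hηtop, ← ENNReal.tsum_geometric, ← ENNReal.tsum_mul_right]
    exact ENNReal.tsum_le_tsum hk

end Boyd

/-! ### The adjoint Hardy operator -/

section Averaging

/-- The adjoint Hardy operator of a decreasing function is dominated by a sum of dilations. -/
theorem lintegral_Ioi_div_le_tsum {G : ℝ → ℝ≥0∞} (hG : Antitone G) {a b : ℝ} (ha : 0 < a)
    (hb : 1 < b) : ∫⁻ t in Set.Ioi a, G t / ENNReal.ofReal t ≤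
      ENNReal.ofReal (b - 1) * ∑' k : ℕ, G (a * b ^ k) := by
  have hcov : Set.Ioi a ⊆ ⋃ k : ℕ, Set.Ico (a * b ^ k) (a * b ^ (k + 1)) := by
    intro t ht
    have ht' : a < t := ht
    obtain ⟨k, hk1, hk2⟩ := exists_nat_pow_near ((one_le_div ha).2 ht'.le) hb
    refine Set.mem_iUnion.2 ⟨k, ?_, ?_⟩
    · rw [mul_comm]; exact (le_div_iff₀ ha).1 hk1
    · rw [mul_comm]; exact (div_lt_iff₀ ha).1 hk2
  refine (lintegral_mono' (Measure.restrict_mono hcov le_rfl) le_rfl).trans ?_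
  refine (lintegral_iUnion_le _ _).trans ?_
  rw [← ENNReal.tsum_mul_left]
  refine ENNReal.tsum_le_tsum fun k => ?_
  have hpos : 0 < a * b ^ k := by positivity
  -- Each geometric block has length b - 1 times its left endpoint, which cancels the weight 1/t.
  calc ∫⁻ t in Set.Ico (a * b ^ k) (a * b ^ (k + 1)), G t / ENNReal.ofReal t
      ≤ ∫⁻ _ in Set.Ico (a * b ^ k) (a * b ^ (k + 1)),
          G (a * b ^ k) / ENNReal.ofReal (a * b ^ k) := by
        refine setLIntegral_mono measurable_const fun t ht => ?_
        exact ENNReal.div_le_div (hG ht.1) (ENNReal.ofReal_le_ofReal ht.1)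
    _ = G (a * b ^ k) / ENNReal.ofReal (a * b ^ k) *
          (ENNReal.ofReal (a * b ^ k) * ENNReal.ofReal (b - 1)) := by
        rw [setLIntegral_const, Real.volume_Ico, ← ENNReal.ofReal_mul hpos.le]
        congr 2; ring
    _ = _ := by
        rw [← mul_assoc, ENNReal.div_mul_cancel (by simpa using hpos) ENNReal.ofReal_ne_top,
          mul_comm]

/-- The linearised adjoint of the maximal operator at `f`, applied to a function with
rearrangement `G`. -/
noncomputable def adjointHardy {α : Type*} [MeasurableSpace α] (μ : Measure α) (f : α → ℝ≥0∞)
    (G : ℝ → ℝ≥0∞) (x : α) : ℝ≥0∞ :=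
  ∫⁻ t in Set.Ioi 0, {t | decRearr μ f t < f x}.indicator (fun t => G t / ENNReal.ofReal t) t

variable {α : Type*} [MeasurableSpace α] {μ : Measure α} {f : α → ℝ≥0∞} {G : ℝ → ℝ≥0∞}

theorem measurableSet_decRearr_lt (hf : Measurable f) :
    MeasurableSet {p : α × ℝ | decRearr μ f p.2 < f p.1} :=
  measurableSet_lt ((measurable_decRearr μ f).comp measurable_snd) (hf.comp measurable_fst)

theorem measurable_adjointHardy (hf : Measurable f) (hG : Measurable G) :
    Measurable (adjointHardy μ f G) := by
  refine Measurable.lintegral_prod_right' (f := fun p : α × ℝ =>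
    {p : α × ℝ | decRearr μ f p.2 < f p.1}.indicator (fun p => G p.2 / ENNReal.ofReal p.2) p) ?_
  refine Measurable.indicator ?_ (measurableSet_decRearr_lt hf)
  fun_prop

/-- Off the set {f > f*(a)}, of measure at most a, the condition f*(t) < f(x) forces t > a. The
resulting bound no longer involves f. -/
theorem decRearr_adjointHardy_le (f : α → ℝ≥0∞) (G : ℝ → ℝ≥0∞) (a : ℝ) :
    decRearr μ (adjointHardy μ f G) a ≤ ∫⁻ t in Set.Ioi a, G t / ENNReal.ofReal t := by
  refine decRearr_le_of_distribution_le (le_trans (measure_mono fun x hx => ?_)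
    (distribution_decRearr_le f a))
  by_contra! hc
  have hfa : f x ≤ decRearr μ f a := not_lt.1 hc
  have hx' : ∫⁻ t in Set.Ioi a, G t / ENNReal.ofReal t < adjointHardy μ f G x := hx
  refine absurd hx' (not_lt.2 ?_)
  calc adjointHardy μ f G x
      ≤ ∫⁻ t, (Set.Ioi a).indicator (fun t => G t / ENNReal.ofReal t) t := by
        refine lintegral_mono' Measure.restrict_le_self fun t => ?_
        refine Set.indicator_le_indicator_of_subset (fun s hs => ?_) (fun _ => zero_le) t
        by_contra! hsa
        have hs' : decRearr μ f s < f x := hs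
        exact absurd (hfa.trans (decRearr_anti μ f (not_lt.1 hsa))) (not_le.2 hs')
    _ = _ := lintegral_indicator measurableSet_Ioi _

/-- Tonelli on {(x, t) : f*(t) < f(x)}: slices in t define `adjointHardy`, slices in x are the sets
on which `decRearr_maximal_mul_le` integrates f. -/
theorem setLIntegral_mul_adjointHardy [SFinite μ] (hf : Measurable f) (hG : Measurable G) :
    ∫⁻ x, f x * adjointHardy μ f G x ∂μ = ∫⁻ t in Set.Ioi 0,
      (∫⁻ x in {x | decRearr μ f t < f x}, f x ∂μ) * (G t / ENNReal.ofReal t) := by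
  let k : α × ℝ → ℝ≥0∞ :=
    {p : α × ℝ | decRearr μ f p.2 < f p.1}.indicator (fun p => G p.2 / ENNReal.ofReal p.2)
  have hk : Measurable k := by
    refine Measurable.indicator ?_ (measurableSet_decRearr_lt hf)
    fun_prop
  calc ∫⁻ x, f x * adjointHardy μ f G x ∂μ
      = ∫⁻ x, (∫⁻ t in Set.Ioi (0 : ℝ), f x * k (x, t)) ∂μ := by
        refine lintegral_congr fun x => ?_
        exact (lintegral_const_mul (f x) (f := fun t => k (x, t))
          (hk.comp measurable_prodMk_left)).symm
    _ = ∫⁻ t in Set.Ioi (0 : ℝ), (∫⁻ x, f x * k (x, t) ∂μ) := by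
        refine lintegral_lintegral_swap (Measurable.aemeasurable ?_)
        exact (hf.comp measurable_fst).mul hk
    _ = _ := by
        refine lintegral_congr fun t => ?_
        have hA : MeasurableSet {x | decRearr μ f t < f x} := measurableSet_lt measurable_const hf
        rw [← lintegral_indicator hA, ← lintegral_mul_const _ (hf.indicator hA)]
        refine lintegral_congr fun x => ?_
        by_cases hx : decRearr μ f t < f x
        · rw [Set.indicator_of_mem (show x ∈ {x | decRearr μ f t < f x} from hx),
            show k (x, t) = G t / ENNReal.ofReal t from
              Set.indicator_of_mem
                (show (x, t) ∈ {p : α × ℝ | decRearr μ f p.2 < f p.1} from hx) _]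
        · rw [Set.indicator_of_notMem (show x ∉ {x | decRearr μ f t < f x} from hx),
            show k (x, t) = 0 from
              Set.indicator_of_notMem
                (show (x, t) ∉ {p : α × ℝ | decRearr μ f p.2 < f p.1} from hx) _,
              zero_mul, mul_zero]

end Averaging

/-! ### The maximal operator on the associate space, by duality -/

section

variable {n : ℕ}

/-- Moves the maximal operator off f: what remains is f itself paired with a function whose
rearrangement is controlled by g alone. -/
theorem lintegral_maximal_mul_le {μ : Measure (Fin n → ℝ)} [SFinite μ] {D : ℝ≥0}
    (hμ : DoublingOnCubes μ D) {f g : (Fin n → ℝ) → ℝ≥0∞} (hf : Measurable f)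
    (hsupp : μ {x | 0 < f x} < ∞) (hint : ∫⁻ x, f x ∂μ ≠ ∞)
    (hlev : ∀ s ≠ 0, μ {x | f x = s} = 0) (hg : AEMeasurable g μ) :
    ∫⁻ x, maximal μ f x * g x ∂μ ≤
      (D + 2) * ∫⁻ x, f x * adjointHardy μ f (decRearr μ g) x ∂μ := by
  have hD : ((D : ℝ≥0∞) + 2) ≠ ∞ := by simp
  refine (lintegral_mul_le_lintegral_decRearr_mul
    (measurable_maximal μ f).aemeasurable hg).trans ?_
  rw [setLIntegral_mul_adjointHardy hf (measurable_decRearr μ g), ← lintegral_const_mul' _ _ hD,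
    ← setLIntegral_congr (μ := volume) (Ioi_ae_eq_Ici (a := (0 : ℝ)))]
  refine setLIntegral_mono' measurableSet_Ioi fun t ht => ?_
  have ht0 : (0 : ℝ) < t := ht
  have ht0' : ENNReal.ofReal t ≠ 0 := by simpa using ht0
  have h := decRearr_maximal_mul_le hμ hf hsupp hint hlev ht0
  calc decRearr μ (maximal μ f) t * decRearr μ g t
      = decRearr μ (maximal μ f) t * ENNReal.ofReal t *
          (decRearr μ g t / ENNReal.ofReal t) := by
        rw [mul_assoc, ENNReal.mul_div_cancel ht0' ENNReal.ofReal_ne_top]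
    _ ≤ _ := by rw [← mul_assoc]; gcongr

/-- The truncation of a function in size and support. -/
noncomputable def truncation (f : (Fin n → ℝ) → ℝ≥0∞) (N : ℕ) : (Fin n → ℝ) → ℝ≥0∞ :=
  (Metric.ball 0 N).indicator fun x => min (f x) N

theorem measurable_truncation {f : (Fin n → ℝ) → ℝ≥0∞} (hf : Measurable f) (N : ℕ) :
    Measurable (truncation f N) :=
  (hf.min measurable_const).indicator measurableSet_ball

theorem monotone_truncation (f : (Fin n → ℝ) → ℝ≥0∞) : Monotone (truncation f) := by
  intro i j hij x
  refine (Set.indicator_le_indicator_of_subset (Metric.ball_subset_ball (Nat.cast_le.2 hij))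
    (fun _ => zero_le) x).trans ?_
  exact Set.indicator_le_indicator (min_le_min_left _ (Nat.cast_le.2 hij))

theorem truncation_le (f : (Fin n → ℝ) → ℝ≥0∞) (N : ℕ) (x : Fin n → ℝ) :
    truncation f N x ≤ f x :=
  Set.indicator_apply_le' (fun _ => min_le_left _ _) fun _ => zero_le

theorem truncation_le_indicator (f : (Fin n → ℝ) → ℝ≥0∞) (N : ℕ) (x : Fin n → ℝ) :
    truncation f N x ≤ (Metric.ball 0 (N : ℝ)).indicator (fun _ => (N : ℝ≥0∞)) x :=
  Set.indicator_le_indicator (min_le_right _ _)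

theorem truncation_le_natCast (f : (Fin n → ℝ) → ℝ≥0∞) (N : ℕ) (x : Fin n → ℝ) :
    truncation f N x ≤ N :=
  Set.indicator_apply_le' (fun _ => min_le_right _ _) fun _ => zero_le

theorem truncation_ne_top (f : (Fin n → ℝ) → ℝ≥0∞) (N : ℕ) (x : Fin n → ℝ) :
    truncation f N x ≠ ∞ :=
  ne_top_of_le_ne_top (ENNReal.natCast_ne_top N) (truncation_le_natCast f N x)

theorem iSup_truncation (f : (Fin n → ℝ) → ℝ≥0∞) (x : Fin n → ℝ) :
    ⨆ N, truncation f N x = f x := by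
  refine le_antisymm (iSup_le fun N => truncation_le f N x) (le_of_forall_lt fun a ha => ?_)
  obtain ⟨N₁, hN₁⟩ := exists_nat_gt (dist x 0)
  obtain ⟨N₂, hN₂⟩ := ENNReal.exists_nat_gt ha.ne_top
  refine lt_iSup_iff.2 ⟨max N₁ N₂, ?_⟩
  have hx : x ∈ Metric.ball 0 ((max N₁ N₂ : ℕ) : ℝ) := Metric.mem_ball.2 (hN₁.trans_le (by simp))
  rw [truncation, Set.indicator_of_mem hx, lt_min_iff]
  exact ⟨ha, hN₂.trans_le (by simp)⟩

variable [NeZero n] {X : BanachFunctionNorm (volume : Measure (Fin n → ℝ))}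
  {v : (Fin n → ℝ) → ℝ≥0∞}

/-- K is uniform in f because the bound on the rearrangement of `adjointHardy` is. -/
theorem exists_weightedNorm_adjointHardy_le (hq : upperBoydIndex X < ∞)
    (v : (Fin n → ℝ) → ℝ≥0∞) :
    ∃ K : ℝ≥0, ∀ f g : (Fin n → ℝ) → ℝ≥0∞, weightedNorm X v g ≠ ∞ →
      weightedNorm X v (adjointHardy (volume.withDensity v) f
        (decRearr (volume.withDensity v) g)) ≤ K * weightedNorm X v g := by
  obtain ⟨b, hb, K, hK⟩ := exists_norm_tsum_dilation_le hq
  refine ⟨(b - 1).toNNReal * K, fun f g hg => ?_⟩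
  set μ := volume.withDensity v
  have hm : Measurable fun s : ℝ => ∑' k : ℕ, decRearr μ g (s * b ^ k) :=
    Measurable.tsum fun k => (measurable_decRearr μ g).comp (by fun_prop)
  have hle : decRearr μ (adjointHardy μ f (decRearr μ g)) ≤ᵐ[halfLine]
      fun s => ((b - 1).toNNReal : ℝ≥0∞) * ∑' k : ℕ, decRearr μ g (s * b ^ k) := by
    rw [halfLine, Measure.restrict_congr_set (Ioi_ae_eq_Ici (a := (0 : ℝ))).symm]
    filter_upwards [ae_restrict_mem measurableSet_Ioi] with a ha
    exact (decRearr_adjointHardy_le f _ a).trans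
      (lintegral_Ioi_div_le_tsum (decRearr_anti μ g) ha hb)
  refine (X.rep.norm_mono _ _ (aemeasurable_decRearr _ _ _)
    (hm.const_mul _).aemeasurable hle).trans ?_
  rw [X.rep.norm_smul _ _ hm.aemeasurable, ENNReal.coe_mul, mul_assoc]
  gcongr
  exact hK _ (measurable_decRearr μ g) hg

theorem weightedAssociateNorm_mono {f g : (Fin n → ℝ) → ℝ≥0∞}
    (h : f ≤ᵐ[volume.withDensity v] g) :
    weightedAssociateNorm X v f ≤ weightedAssociateNorm X v g := by
  refine iSup_mono fun k => iSup_mono fun _ => iSup_mono fun _ => lintegral_mono_ae ?_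
  filter_upwards [h] with x hx
  gcongr

theorem weightedAssociateNorm_congr {f g : (Fin n → ℝ) → ℝ≥0∞}
    (h : f =ᵐ[volume.withDensity v] g) :
    weightedAssociateNorm X v f = weightedAssociateNorm X v g :=
  le_antisymm (weightedAssociateNorm_mono h.le) (weightedAssociateNorm_mono h.symm.le)

theorem lintegral_le_weightedAssociateNorm (f : (Fin n → ℝ) → ℝ≥0∞) {g : (Fin n → ℝ) → ℝ≥0∞}
    (hg : AEMeasurable g (volume.withDensity v)) (hg1 : weightedNorm X v g ≤ 1) :
    ∫⁻ x, f x * g x ∂volume.withDensity v ≤ weightedAssociateNorm X v f :=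
  le_iSup_of_le (f := fun g : (Fin n → ℝ) → ℝ≥0∞ =>
      ⨆ (_ : AEMeasurable g (volume.withDensity v)) (_ : weightedNorm X v g ≤ 1),
        ∫⁻ x, f x * g x ∂volume.withDensity v) g
    (le_iSup_of_le hg (le_iSup_of_le hg1 le_rfl))

theorem weightedAssociateNorm_le {f : (Fin n → ℝ) → ℝ≥0∞} {C : ℝ≥0∞}
    (h : ∀ g, AEMeasurable g (volume.withDensity v) → weightedNorm X v g ≤ 1 →
      ∫⁻ x, f x * g x ∂volume.withDensity v ≤ C) : weightedAssociateNorm X v f ≤ C :=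
  iSup_le fun g => iSup_le fun hg => iSup_le fun hg1 => h g hg hg1

theorem weightedAssociateNorm_const_mul (c : ℝ≥0) (f : (Fin n → ℝ) → ℝ≥0∞) :
    weightedAssociateNorm X v (fun x => c * f x) = c * weightedAssociateNorm X v f := by
  unfold weightedAssociateNorm associateNorm
  simp only [ENNReal.mul_iSup]
  congr! 6 with g hg hg1
  rw [← lintegral_const_mul' _ _ ENNReal.coe_ne_top]
  simp only [mul_assoc]

theorem weightedAssociateNorm_tsum_le {f : ℕ → (Fin n → ℝ) → ℝ≥0∞}
    (hf : ∀ k, AEMeasurable (f k) (volume.withDensity v)) :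
    weightedAssociateNorm X v (fun x => ∑' k, f k x) ≤ ∑' k, weightedAssociateNorm X v (f k) := by
  refine weightedAssociateNorm_le fun g hg hg1 => ?_
  simp only [← ENNReal.tsum_mul_right]
  rw [lintegral_tsum (f := fun k x => f k x * g x) fun k => (hf k).mul hg]
  exact ENNReal.tsum_le_tsum fun k => lintegral_le_weightedAssociateNorm _ hg hg1

/-- Hölder's inequality for `X_v` and its associate space. -/
theorem lintegral_mul_le_weightedAssociateNorm_mul (f : (Fin n → ℝ) → ℝ≥0∞)
    {g : (Fin n → ℝ) → ℝ≥0∞} (hg : AEMeasurable g (volume.withDensity v))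
    (hgtop : weightedNorm X v g ≠ ∞) :
    ∫⁻ x, f x * g x ∂volume.withDensity v ≤
      weightedAssociateNorm X v f * weightedNorm X v g := by
  rcases eq_or_ne (weightedNorm X v g) 0 with h0 | h0
  · rw [lintegral_eq_zero_of_ae_eq_zero]
    · exact zero_le
    · filter_upwards [weightedNorm_eq_zero h0] with x hx
      simp [hx]
  rcases eq_or_ne (weightedAssociateNorm X v f) ∞ with hf | hf
  · rw [hf, ENNReal.top_mul h0]; exact le_top
  refine le_mul_of_forall_smul_le hf hgtop fun c hc hc1 => ?_
  rw [← lintegral_const_mul' _ _ ENNReal.coe_ne_top]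
  simp only [mul_left_comm (c : ℝ≥0∞)]
  refine lintegral_le_weightedAssociateNorm f (hg.const_mul _) ?_
  rwa [weightedNorm_smul hc]

/-- For truncations, pass to a comparable function with null level sets, move M onto g and apply
Hölder; monotone convergence removes the truncation. Of the constant, 4 comes from the two
comparisons by a factor 2, D + 2 from the rearrangement estimate and K from the adjoint operator. -/
theorem exists_weightedAssociateNorm_maximal_le (hq : upperBoydIndex X < ∞) {D : ℝ≥0}
    (hμ : DoublingOnCubes (volume.withDensity v) D) :
    ∃ C : ℝ≥0, ∀ h : (Fin n → ℝ) → ℝ≥0∞, AEMeasurable h (volume.withDensity v) →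
      weightedAssociateNorm X v (maximal (volume.withDensity v) h) ≤
        C * weightedAssociateNorm X v h := by
  obtain ⟨K, hK⟩ := exists_weightedNorm_adjointHardy_le hq v
  refine ⟨4 * (D + 2) * K, fun h₀ hh₀ => weightedAssociateNorm_le fun g hg hg1 => ?_⟩
  set μ := volume.withDensity v with hμdef
  set h := hh₀.mk h₀ with hh
  have hm : Measurable h := hh₀.measurable_mk
  rw [maximal_congr_ae hh₀.ae_eq_mk, weightedAssociateNorm_congr hh₀.ae_eq_mk]
  let t : ℕ → (Fin n → ℝ) → ℝ≥0∞ := truncation h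
  have ht : ∀ N, Measurable (t N) := fun N => measurable_truncation hm N
  have htmono : Monotone t := monotone_truncation h
  have hbound : ∀ N, ∫⁻ x, maximal μ (t N) x * g x ∂μ ≤
      ((4 * (D + 2) * K : ℝ≥0) : ℝ≥0∞) * weightedAssociateNorm X v h := by
    intro N
    obtain ⟨f, hf, hf1, hf2, hf3⟩ := exists_comparable_null_level_sets (ht N)
      (truncation_ne_top h N)
    have hf1' : ∀ x, maximal μ (t N) x ≤ 2 * maximal μ f x := fun x =>
      (maximal_mono_ae (Filter.Eventually.of_forall hf1) x).trans
        (maximal_const_mul_le ENNReal.ofNat_ne_top x)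
    have hsupp : μ {x | 0 < f x} < ∞ := by
      refine lt_of_le_of_lt (measure_mono fun x (hx : 0 < f x) => ?_) (hμ.lt_top 0 N)
      by_contra hxE
      have : t N x = 0 := Set.indicator_of_notMem hxE _
      have h2 := hf2 x
      rw [this, mul_zero] at h2
      exact hx.not_ge h2
    have hint : ∫⁻ x, f x ∂μ ≠ ∞ := by
      refine ne_top_of_le_ne_top ?_ (lintegral_mono hf2)
      rw [lintegral_const_mul _ (ht N)]
      refine ENNReal.mul_ne_top ENNReal.ofNat_ne_top (ne_top_of_le_ne_top ?_
        (lintegral_mono (truncation_le_indicator h N)))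
      rw [lintegral_indicator measurableSet_ball, setLIntegral_const]
      exact ENNReal.mul_ne_top (by simp) (hμ.lt_top 0 N).ne
    have hlev : ∀ s ≠ 0, μ {x | f x = s} = 0 := fun s hs =>
      withDensity_absolutelyContinuous volume v (hf3 s hs)
    have hg1' : weightedNorm X v g ≠ ∞ := ne_top_of_le_ne_top ENNReal.one_ne_top hg1
    have hS := hK f g hg1'
    have hSm : Measurable (adjointHardy μ f (decRearr μ g)) :=
      measurable_adjointHardy hf (measurable_decRearr μ g)
    calc ∫⁻ x, maximal μ (t N) x * g x ∂μ
        ≤ ∫⁻ x, 2 * (maximal μ f x * g x) ∂μ := by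
          refine lintegral_mono fun x => ?_
          rw [← mul_assoc]
          gcongr
          exact hf1' x
      _ = 2 * ∫⁻ x, maximal μ f x * g x ∂μ := lintegral_const_mul' _ _ ENNReal.ofNat_ne_top
      _ ≤ 2 * ((D + 2) * ∫⁻ x, f x * adjointHardy μ f (decRearr μ g) x ∂μ) := by
          gcongr
          exact lintegral_maximal_mul_le hμ hf hsupp hint hlev hg
      _ ≤ 2 * ((D + 2) * (2 * ∫⁻ x, h x * adjointHardy μ f (decRearr μ g) x ∂μ)) := by
          gcongr
          rw [← lintegral_const_mul' _ _ ENNReal.ofNat_ne_top]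
          refine lintegral_mono fun x => ?_
          rw [← mul_assoc]
          gcongr
          exact (hf2 x).trans (by gcongr; exact truncation_le h N x)
      _ ≤ 2 * ((D + 2) * (2 * (weightedAssociateNorm X v h * K))) := by
          gcongr
          refine (lintegral_mul_le_weightedAssociateNorm_mul h hSm.aemeasurable
            (ne_top_of_le_ne_top (ENNReal.mul_ne_top ENNReal.coe_ne_top hg1') hS)).trans ?_
          gcongr
          exact hS.trans (mul_le_of_le_one_right zero_le hg1)
      _ = _ := by push_cast; ring
  have hM : ∀ x, maximal μ h x = ⨆ N, maximal μ (t N) x := fun x => by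
    rw [← maximal_iSup (fun k => (ht k).aemeasurable) htmono]
    congr 1
    exact (funext (iSup_truncation h)).symm
  have hMg : ∀ x, maximal μ h x * g x = ⨆ N, maximal μ (t N) x * g x := fun x => by
    rw [hM, ENNReal.iSup_mul]
  rw [lintegral_congr hMg]
  rw [lintegral_iSup' (f := fun N x => maximal μ (t N) x * g x)
    (fun N => (measurable_maximal μ (t N)).aemeasurable.mul hg)]
  · exact iSup_le hbound
  · refine Filter.Eventually.of_forall fun x i j hij => ?_
    have := maximal_mono_ae (μ := μ) (Filter.Eventually.of_forall fun x => htmono hij x) x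
    exact mul_le_mul' this le_rfl

theorem maximalOpNorm_lt_top (hq : upperBoydIndex X < ∞) {D : ℝ≥0}
    (hμ : DoublingOnCubes (volume.withDensity v) D) : maximalOpNorm X v < ∞ := by
  obtain ⟨C, hC⟩ := exists_weightedAssociateNorm_maximal_le hq hμ
  refine lt_of_le_of_lt (iSup_le fun h => iSup_le fun hh => iSup_le fun h1 => ?_)
    (ENNReal.coe_lt_top (r := C))
  exact (hC h (hh.mono_ac (withDensity_absolutelyContinuous volume v))).trans
    (mul_le_of_le_one_right zero_le h1)

end

/-! ### Duality -/

section LorentzLuxemburg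

variable {α : Type*} [MeasurableSpace α] {ν : Measure α}

/-- The part of the axioms of a function norm used in the Lorentz–Luxemburg theorem. -/
structure IsFatouNorm (ν : Measure α) (ρ : (α → ℝ≥0∞) → ℝ≥0∞) : Prop where
  mono : ∀ f g, AEMeasurable f ν → AEMeasurable g ν → f ≤ᵐ[ν] g → ρ f ≤ ρ g
  add_le : ∀ f g, AEMeasurable f ν → AEMeasurable g ν → ρ (f + g) ≤ ρ f + ρ g
  smul : ∀ (c : ℝ≥0) f, AEMeasurable f ν → ρ (fun x => c * f x) = c * ρ f
  iSup : ∀ f : ℕ → α → ℝ≥0∞, (∀ j, AEMeasurable (f j) ν) →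
    (∀ᵐ x ∂ν, Monotone fun j => f j x) → ρ (fun x => ⨆ j, f j x) = ⨆ j, ρ (f j)

theorem IsFatouNorm.congr {ρ : (α → ℝ≥0∞) → ℝ≥0∞} (hρ : IsFatouNorm ν ρ) {f g : α → ℝ≥0∞}
    (hf : AEMeasurable f ν) (hg : AEMeasurable g ν) (h : f =ᵐ[ν] g) : ρ f = ρ g :=
  le_antisymm (hρ.mono f g hf hg h.le) (hρ.mono g f hg hf h.symm.le)

theorem IsFatouNorm.convex_unitBall {ρ : (α → ℝ≥0∞) → ℝ≥0∞} (hρ : IsFatouNorm ν ρ) :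
    Convex ℝ {s : Lp ℝ 2 ν | ρ (fun x => ‖s x‖ₑ) ≤ 1} := by
  intro s hs t ht a b ha hb hab
  have hs' : ρ (fun x => ‖s x‖ₑ) ≤ 1 := hs
  have ht' : ρ (fun x => ‖t x‖ₑ) ≤ 1 := ht
  have hsm : AEMeasurable (fun x => ‖s x‖ₑ) ν := (Lp.aestronglyMeasurable s).enorm
  have htm : AEMeasurable (fun x => ‖t x‖ₑ) ν := (Lp.aestronglyMeasurable t).enorm
  lift a to ℝ≥0 using ha
  lift b to ℝ≥0 using hb
  calc ρ (fun x => ‖((a : ℝ) • s + (b : ℝ) • t : Lp ℝ 2 ν) x‖ₑ)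
      ≤ ρ ((fun x => (a : ℝ≥0∞) * ‖s x‖ₑ) + fun x => (b : ℝ≥0∞) * ‖t x‖ₑ) := by
        refine hρ.mono _ _ (Lp.aestronglyMeasurable _).enorm
          ((hsm.const_mul _).add (htm.const_mul _)) ?_
        filter_upwards [Lp.coeFn_add ((a : ℝ) • s) ((b : ℝ) • t), Lp.coeFn_smul (a : ℝ) s,
          Lp.coeFn_smul (b : ℝ) t] with x h1 h2 h3
        rw [h1, Pi.add_apply, h2, h3, Pi.smul_apply, Pi.smul_apply, Pi.add_apply]
        refine (enorm_add_le _ _).trans (le_of_eq ?_)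
        simp
    _ ≤ a * ρ (fun x => ‖s x‖ₑ) + b * ρ (fun x => ‖t x‖ₑ) := by
        rw [← hρ.smul a _ hsm, ← hρ.smul b _ htm]
        exact hρ.add_le _ _ (hsm.const_mul _) (htm.const_mul _)
    _ ≤ a * 1 + b * 1 := by gcongr
    _ = 1 := by
        rw [mul_one, mul_one, ← ENNReal.coe_add, ← ENNReal.coe_one, ENNReal.coe_inj]
        exact_mod_cast hab

/-- An L² limit is an almost everywhere limit along a subsequence. The infima F j of the tails
increase, dominate the limit in the supremum, and each lies below a member of the ball; the Fatou
property does the rest. -/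
theorem IsFatouNorm.isClosed_unitBall {ρ : (α → ℝ≥0∞) → ℝ≥0∞} (hρ : IsFatouNorm ν ρ) :
    IsClosed {s : Lp ℝ 2 ν | ρ (fun x => ‖s x‖ₑ) ≤ 1} := by
  refine IsSeqClosed.isClosed fun s s₀ hs hlim => ?_
  obtain ⟨φ, -, hφ⟩ := (tendstoInMeasure_of_tendsto_Lp hlim).exists_seq_tendsto_ae
  have hm : ∀ k, AEMeasurable (fun x => ‖s k x‖ₑ) ν := fun k =>
    (Lp.aestronglyMeasurable (s k)).enorm
  let F : ℕ → α → ℝ≥0∞ := fun j x => ⨅ k : ℕ, ‖s (φ (j + k)) x‖ₑ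
  have hF : ∀ j, AEMeasurable (F j) ν := fun j => AEMeasurable.iInf fun k => hm _
  have hFmono : ∀ x, Monotone fun j => F j x := fun x i j hij => le_iInf fun k =>
    iInf_le_of_le (j - i + k) (by rw [show i + (j - i + k) = j + k by omega])
  have hle : (fun x => ‖s₀ x‖ₑ) ≤ᵐ[ν] fun x => ⨆ j, F j x := by
    filter_upwards [hφ] with x hx
    refine le_of_forall_lt fun a ha => ?_
    obtain ⟨b, hab, hb⟩ := exists_between ha
    obtain ⟨N, hN⟩ := Filter.eventually_atTop.1
      (((continuous_enorm.tendsto _).comp hx).eventually (lt_mem_nhds hb))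
    exact lt_of_lt_of_le hab (le_iSup_of_le N (le_iInf fun k => (hN _ (by omega)).le))
  refine (hρ.mono _ _ (Lp.aestronglyMeasurable s₀).enorm (AEMeasurable.iSup hF) hle).trans ?_
  rw [hρ.iSup F hF (Filter.Eventually.of_forall hFmono)]
  exact iSup_le fun j => (hρ.mono _ _ (hF j) (hm _) (Filter.Eventually.of_forall fun x =>
    iInf_le _ 0)).trans (hs (φ (j + 0)))

/-- The Lorentz–Luxemburg theorem on a finite measure space: a bounded function outside the unit
ball is separated from it by a nonnegative function. -/
theorem IsFatouNorm.exists_separating [IsFiniteMeasure ν] {ρ : (α → ℝ≥0∞) → ℝ≥0∞}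
    (hρ : IsFatouNorm ν ρ) {f : α → ℝ≥0} (hf : Measurable f) {N : ℝ≥0} (hN : ∀ x, f x ≤ N)
    (h1 : 1 < ρ fun x => f x) :
    ∃ h : α → ℝ≥0∞, Measurable h ∧ 1 < ∫⁻ x, f x * h x ∂ν ∧
      ∀ g, AEMeasurable g ν → ρ g ≤ 1 → ∫⁻ x, g x * h x ∂ν ≤ 1 := by
  have hfL : MemLp (fun x => (f x : ℝ)) 2 ν := by
    refine MemLp.of_bound (by fun_prop) N (Filter.Eventually.of_forall fun x => ?_)
    simpa using hN x
  let F : Lp ℝ 2 ν := hfL.toLp _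
  have hF : F =ᵐ[ν] fun x => (f x : ℝ) := hfL.coeFn_toLp
  have hnot : F ∉ {s : Lp ℝ 2 ν | ρ (fun x => ‖s x‖ₑ) ≤ 1} := by
    intro hc
    have hc' : ρ (fun x => ‖F x‖ₑ) ≤ 1 := hc
    rw [hρ.congr (g := fun x => (f x : ℝ≥0∞)) (Lp.aestronglyMeasurable _).enorm
      (by fun_prop)] at hc'
    · exact absurd hc' (not_le.2 h1)
    · filter_upwards [hF] with x hx
      rw [hx, Real.enorm_eq_ofReal (NNReal.coe_nonneg _), ENNReal.ofReal_coe_nnreal]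
  -- Hahn–Banach separation in L²; Riesz representation turns Φ into integration against y.
  obtain ⟨Φ, c, hc, hcf⟩ := geometric_hahn_banach_closed_point hρ.convex_unitBall
    hρ.isClosed_unitBall hnot
  let y : Lp ℝ 2 ν := (InnerProductSpace.toDual ℝ (Lp ℝ 2 ν)).symm Φ
  have hΦ : ∀ s : Lp ℝ 2 ν, Φ s = ∫ x, s x * y x ∂ν := fun s => by
    rw [← InnerProductSpace.toDual_symm_apply (𝕜 := ℝ) (x := s) (y := Φ), L2.inner_def]
    rfl
  have hρ0 : ρ (fun _ => 0) = 0 := by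
    simpa using hρ.smul 0 (fun _ => 0) aemeasurable_const
  -- The ball contains 0, so c is positive and |y| may be divided by c to normalise the separation
  -- at 1.
  have hc0 : 0 < c := by
    have : Φ 0 < c := hc 0 (by
      have : ρ (fun x => ‖(0 : Lp ℝ 2 ν) x‖ₑ) = 0 := by
        rw [hρ.congr (g := fun _ => 0) (Lp.aestronglyMeasurable _).enorm aemeasurable_const, hρ0]
        filter_upwards [Lp.coeFn_zero ℝ 2 ν] with x hx
        rw [hx]; simp
      exact this.le.trans zero_le_one)
    simpa using this
  obtain ⟨y', hy'm, hy'⟩ : ∃ y' : α → ℝ, Measurable y' ∧ y =ᵐ[ν] y' :=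
    ⟨_, (Lp.aestronglyMeasurable y).aemeasurable.measurable_mk,
      (Lp.aestronglyMeasurable y).aemeasurable.ae_eq_mk⟩
  have hyL : MemLp y' 2 ν := (memLp_congr_ae hy').1 (Lp.memLp y)
  have hcne : ENNReal.ofReal c ≠ 0 := by simpa using hc0
  have hbdd : ∀ g : α → ℝ≥0, Measurable g → ∀ B : ℝ≥0, (∀ x, g x ≤ B) →
      ρ (fun x => g x) ≤ 1 → ∫⁻ x, g x * ‖y' x‖ₑ ∂ν ≤ ENNReal.ofReal c := by
    intro g hg B hB hg1
    -- Giving g the sign of y' does not change |g|, so it stays in the ball; hence the bound holds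
    -- with |y'| in place of y'.
    let σ : α → ℝ := fun x => if 0 ≤ y' x then (g x : ℝ) else -(g x : ℝ)
    have hσm : Measurable σ :=
      Measurable.ite (measurableSet_le measurable_const hy'm) (by fun_prop) (by fun_prop)
    have hσn : ∀ x, ‖σ x‖ = g x := fun x => by
      by_cases h : 0 ≤ y' x <;> simp [σ, h]
    have hσy : ∀ x, σ x * y' x = g x * |y' x| := fun x => by
      by_cases h : 0 ≤ y' x
      · simp [σ, h, abs_of_nonneg]
      · simp [σ, h, abs_of_neg (not_le.1 h)]
    have hsL : MemLp σ 2 ν := MemLp.of_bound hσm.aestronglyMeasurable B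
      (Filter.Eventually.of_forall fun x => by rw [hσn]; exact_mod_cast hB x)
    let S : Lp ℝ 2 ν := hsL.toLp _
    have hS : S =ᵐ[ν] σ := hsL.coeFn_toLp
    have hmem : ρ (fun x => ‖S x‖ₑ) ≤ 1 := by
      refine (hρ.congr (g := fun x => (g x : ℝ≥0∞)) (Lp.aestronglyMeasurable _).enorm
        (by fun_prop) ?_).trans_le hg1
      filter_upwards [hS] with x hx
      rw [hx, ← ofReal_norm, hσn, ENNReal.ofReal_coe_nnreal]
    have h2 := hc _ hmem
    have h3 : ∫ x, S x * y x ∂ν = ∫ x, (g x : ℝ) * |y' x| ∂ν := by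
      refine integral_congr_ae ?_
      filter_upwards [hS, hy'] with x hx hx'
      rw [hx, hx', hσy]
    rw [hΦ, h3] at h2
    have hint : Integrable (fun x => (g x : ℝ) * |y' x|) ν := by
      refine ((hyL.integrable one_le_two).abs).bdd_mul (c := B) (by fun_prop)
        (Filter.Eventually.of_forall fun x => ?_)
      simpa using hB x
    calc ∫⁻ x, g x * ‖y' x‖ₑ ∂ν = ∫⁻ x, ENNReal.ofReal ((g x : ℝ) * |y' x|) ∂ν := by
          refine lintegral_congr fun x => ?_
          rw [ENNReal.ofReal_mul (NNReal.coe_nonneg _), ENNReal.ofReal_coe_nnreal,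
            Real.enorm_eq_ofReal_abs]
      _ = ENNReal.ofReal (∫ x, (g x : ℝ) * |y' x| ∂ν) :=
          (ofReal_integral_eq_lintegral_ofReal hint
            (Filter.Eventually.of_forall fun x => by positivity)).symm
      _ ≤ _ := ENNReal.ofReal_le_ofReal h2.le
  have hdiv : ∀ g : α → ℝ≥0∞, ∫⁻ x, g x * (‖y' x‖ₑ / ENNReal.ofReal c) ∂ν =
      (∫⁻ x, g x * ‖y' x‖ₑ ∂ν) / ENNReal.ofReal c := fun g => by
    simp only [div_eq_mul_inv, ← mul_assoc]
    exact lintegral_mul_const' _ _ (ENNReal.inv_ne_top.2 hcne)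
  refine ⟨fun x => ‖y' x‖ₑ / ENNReal.ofReal c, by fun_prop, ?_, fun g hg hg1 => ?_⟩
  · rw [hdiv, ENNReal.lt_div_iff_mul_lt (Or.inl hcne) (Or.inl ENNReal.ofReal_ne_top), one_mul]
    rw [hΦ] at hcf
    have hcf' : ENNReal.ofReal c < ENNReal.ofReal (∫ x, F x * y x ∂ν) :=
      (ENNReal.ofReal_lt_ofReal_iff (hc0.trans hcf)).2 hcf
    refine hcf'.trans_le ((Real.ofReal_le_enorm _).trans
      ((enorm_integral_le_lintegral_enorm _).trans (lintegral_congr_ae ?_).le))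
    filter_upwards [hF, hy'] with x hx hx'
    rw [hx, hx', enorm_mul, Real.enorm_eq_ofReal (NNReal.coe_nonneg _), ENNReal.ofReal_coe_nnreal]
  · rw [hdiv]
    refine ENNReal.div_le_of_le_mul ?_
    rw [one_mul]
    let g' := hg.mk g
    have hg'm : Measurable g' := hg.measurable_mk
    have hg' : g =ᵐ[ν] g' := hg.ae_eq_mk
    let G : ℕ → α → ℝ≥0 := fun N x => (min (g' x) N).toNNReal
    have hGc : ∀ N x, (G N x : ℝ≥0∞) = min (g' x) N := fun N x =>
      ENNReal.coe_toNNReal (ne_top_of_le_ne_top (ENNReal.natCast_ne_top N) (min_le_right _ _))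
    have hGm : ∀ N, Measurable (G N) := fun N => (hg'm.min measurable_const).ennreal_toNNReal
    have hsup : ∀ x, ⨆ N, (G N x : ℝ≥0∞) = g' x := fun x => by
      simp only [hGc]
      refine le_antisymm (iSup_le fun N => min_le_left _ _) (le_of_forall_lt fun a ha => ?_)
      obtain ⟨N, hN⟩ := ENNReal.exists_nat_gt ha.ne_top
      exact lt_iSup_iff.2 ⟨N, lt_min ha hN⟩
    calc ∫⁻ x, g x * ‖y' x‖ₑ ∂ν = ∫⁻ x, ⨆ N, (G N x : ℝ≥0∞) * ‖y' x‖ₑ ∂ν := by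
          refine lintegral_congr_ae ?_
          filter_upwards [hg'] with x hx
          rw [← ENNReal.iSup_mul, hsup, hx]
      _ = ⨆ N, ∫⁻ x, (G N x : ℝ≥0∞) * ‖y' x‖ₑ ∂ν := by
          refine lintegral_iSup (fun N => by fun_prop) fun i j hij x => ?_
          simp only [hGc]
          gcongr
      _ ≤ _ := by
          refine iSup_le fun N => hbdd (G N) (hGm N) N (fun x => ?_) (le_trans ?_ hg1)
          · have : (G N x : ℝ≥0∞) ≤ N := (hGc N x).trans_le (min_le_right _ _)
            exact_mod_cast this
          · refine hρ.mono _ _ (by fun_prop) hg ?_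
            filter_upwards [hg'] with x hx
            rw [hGc, hx]
            exact min_le_left _ _

end LorentzLuxemburg

/-! ### Finite measures as images of Lebesgue measure -/

section Transport

theorem measurePreserving_projIcc :
    MeasurePreserving (Set.projIcc (0 : ℝ) 1 zero_le_one)
      (volume.restrict (Set.Icc (0 : ℝ) 1)) (volume : Measure unitInterval) := by
  refine ⟨continuous_projIcc.measurable, ?_⟩
  have h : (volume.restrict (Set.Icc (0 : ℝ) 1)) =
      Measure.map (Subtype.val : unitInterval → ℝ) volume :=
    (map_comap_subtype_coe measurableSet_Icc volume).symm
  rw [h, Measure.map_map continuous_projIcc.measurable measurable_subtype_coe]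
  have hid : Set.projIcc (0 : ℝ) 1 zero_le_one ∘ (Subtype.val : unitInterval → ℝ) = id :=
    funext fun x => Set.projIcc_val zero_le_one x
  rw [hid]
  exact Measure.map_id

theorem map_div_restrict_Icc {m : ℝ} (hm : 0 < m) :
    Measure.map (fun t => t * m⁻¹) (volume.restrict (Set.Icc 0 m)) =
      ENNReal.ofReal m • volume.restrict (Set.Icc (0 : ℝ) 1) := by
  have hpre : (fun t : ℝ => t * m⁻¹) ⁻¹' Set.Icc 0 1 = Set.Icc 0 m := by
    ext t
    simp only [Set.mem_preimage, Set.mem_Icc, ← div_eq_mul_inv, div_le_one hm, le_div_iff₀ hm,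
      zero_mul]
  rw [← hpre, ← Measure.restrict_map (by fun_prop) measurableSet_Icc,
    Real.map_volume_mul_right (inv_ne_zero hm.ne'), inv_inv, abs_of_pos hm, Measure.restrict_smul]

/-- A finite measure on a standard Borel space is the image of Lebesgue measure on a bounded
subset of the half line. -/
theorem exists_measurePreserving_halfLine {α : Type*} [MeasurableSpace α] [StandardBorelSpace α]
    [Nonempty α] (ν : Measure α) [IsFiniteMeasure ν] :
    ∃ (J : Set ℝ) (T : ℝ → α), MeasurableSet J ∧
      MeasurePreserving T (halfLine.restrict J) ν := by
  rcases eq_or_ne ν 0 with rfl | hν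
  · exact ⟨∅, fun _ => Classical.arbitrary α, .empty, measurable_const, by simp⟩
  have hν0 : ν Set.univ ≠ 0 := by simpa using hν
  set m := (ν Set.univ).toReal with hm
  have hm0 : 0 < m := ENNReal.toReal_pos hν0 (measure_ne_top ν _)
  have hmν : ENNReal.ofReal m = ν Set.univ := ENNReal.ofReal_toReal (measure_ne_top ν _)
  have hP : IsProbabilityMeasure ((ν Set.univ)⁻¹ • ν) :=
    ⟨by simpa using ENNReal.inv_mul_cancel hν0 (measure_ne_top ν _)⟩
  -- Every probability measure on a standard Borel space is an image of the uniform measure on [0,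
  -- 1]; rescaling to [0, m] restores the mass.
  obtain ⟨f, hf, hmap⟩ := Measure.exists_measurable_map_eq ((ν Set.univ)⁻¹ • ν)
  have hr : halfLine.restrict (Set.Icc 0 m) = volume.restrict (Set.Icc 0 m) := by
    rw [halfLine, Measure.restrict_restrict measurableSet_Icc,
      Set.inter_eq_self_of_subset_left Set.Icc_subset_Ici_self]
  have hpm := measurePreserving_projIcc
  refine ⟨Set.Icc 0 m, fun t => f (Set.projIcc 0 1 zero_le_one (t * m⁻¹)), measurableSet_Icc,
    hf.comp (hpm.measurable.comp (by fun_prop)), ?_⟩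
  have hcomp : (fun t => f (Set.projIcc 0 1 zero_le_one (t * m⁻¹))) =
      (f ∘ Set.projIcc 0 1 zero_le_one) ∘ fun t : ℝ => t * m⁻¹ := rfl
  rw [hr, hcomp, ← Measure.map_map (hf.comp hpm.measurable) (by fun_prop),
    map_div_restrict_Icc hm0, Measure.map_smul, ← Measure.map_map hf hpm.measurable, hpm.map_eq,
    hmap, hmν, smul_smul, ENNReal.mul_inv_cancel hν0 (measure_ne_top ν _), one_smul]

end Transport

/-! ### Lorentz–Luxemburg duality for X_v -/

section WeightedDuality

variable {α : Type*} [MeasurableSpace α] {ν : Measure α} {J : Set ℝ} {T : ℝ → α}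

/-- Rearrangement is not subadditive, so the triangle inequality is not visible in `weightedNorm`.
Composition with T is linear and inherits it from the norm of Y. -/
theorem isFatouNorm_comp (Y : BanachFunctionNorm halfLine) (hJ : MeasurableSet J)
    (hT : MeasurePreserving T (halfLine.restrict J) ν) :
    IsFatouNorm ν fun s => Y.norm (J.indicator fun t => s (T t)) := by
  have hm : ∀ f : α → ℝ≥0∞, AEMeasurable f ν →
      AEMeasurable (J.indicator fun t => f (T t)) halfLine := fun f hf =>
    (aemeasurable_indicator_iff hJ).2 (hf.comp_quasiMeasurePreserving hT.quasiMeasurePreserving)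
  have hae : ∀ {p : α → Prop}, (∀ᵐ x ∂ν, p x) → ∀ᵐ t ∂halfLine, t ∈ J → p (T t) := fun h =>
    (ae_restrict_iff' hJ).1 (hT.quasiMeasurePreserving.ae h)
  refine ⟨fun f g hf hg h => ?_, fun f g hf hg => ?_, fun c f hf => ?_, fun f hf h => ?_⟩
  · refine Y.norm_mono _ _ (hm f hf) (hm g hg) ?_
    filter_upwards [hae h] with t ht
    by_cases htJ : t ∈ J
    · simpa [htJ] using ht htJ
    · simp [htJ]
  · refine le_trans (le_of_eq ?_) (Y.norm_add_le _ _ (hm f hf) (hm g hg))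
    rw [← Set.indicator_add']
    rfl
  · rw [← Y.norm_smul c _ (hm f hf)]
    congr 1
    ext t
    by_cases htJ : t ∈ J <;> simp [htJ]
  · rw [← Y.norm_iSup _ (fun j => hm _ (hf j))]
    · congr 1
      ext t
      by_cases htJ : t ∈ J <;> simp [htJ]
    · filter_upwards [hae h] with t ht i j hij
      by_cases htJ : t ∈ J
      · simpa [htJ] using ht htJ hij
      · simp [htJ]

variable {n : ℕ} [NeZero n] {X : BanachFunctionNorm (volume : Measure (Fin n → ℝ))}
  {v : (Fin n → ℝ) → ℝ≥0∞}

/-- The two functions are equimeasurable, for μ and for Lebesgue measure, because T preserves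
measure; rearrangement invariance equates the norms. -/
theorem weightedNorm_indicator_eq (hX : X.IsRI) {E : Set (Fin n → ℝ)} (hE : MeasurableSet E)
    (hJ : MeasurableSet J) {T : ℝ → Fin n → ℝ}
    (hT : MeasurePreserving T (halfLine.restrict J) ((volume.withDensity v).restrict E))
    {s : (Fin n → ℝ) → ℝ≥0∞} (hs : AEMeasurable s ((volume.withDensity v).restrict E)) :
    weightedNorm X v (E.indicator s) = X.rep.norm (J.indicator fun t => s (T t)) := by
  set μ := volume.withDensity v
  have key : ∀ {β : Type} (A : Set β) (f : β → ℝ≥0∞) (r : ℝ≥0),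
      {x | (r : ℝ≥0∞) < A.indicator f x} = {x | (r : ℝ≥0∞) < f x} ∩ A := by
    intro β A f r
    ext x
    by_cases hx : x ∈ A <;> simp [hx]
  refine isRI_rep hX _ _ (aemeasurable_decRearr _ _ _) ((aemeasurable_indicator_iff hJ).2
    (hs.comp_quasiMeasurePreserving hT.quasiMeasurePreserving)) fun r => ?_
  rw [equimeasurable_decRearr μ (E.indicator s) r]
  unfold distribution
  rw [key, key, ← Measure.restrict_apply' hE, ← Measure.restrict_apply' hJ]
  exact (hT.measure_preimage (hs.nullMeasurable (measurableSet_Ioi (a := (r : ℝ≥0∞))))).symm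

/-- The norm of `X_v` is determined by its associate norm. -/
theorem weightedNorm_le_of_forall_lintegral_le (hX : X.IsRI)
    (hfin : ∀ N : ℕ, volume.withDensity v (Metric.ball 0 N) < ∞) {F : (Fin n → ℝ) → ℝ≥0∞}
    (hF : AEMeasurable F (volume.withDensity v)) {B : ℝ≥0∞}
    (h : ∀ k : (Fin n → ℝ) → ℝ≥0∞, Measurable k → weightedAssociateNorm X v k ≤ 1 →
      ∫⁻ x, F x * k x ∂volume.withDensity v ≤ B) : weightedNorm X v F ≤ B := by
  set μ := volume.withDensity v
  let F' := hF.mk F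
  have hF'm : Measurable F' := hF.measurable_mk
  have hFF' : F =ᵐ[μ] F' := hF.ae_eq_mk
  refine (weightedNorm_mono hFF'.le).trans ?_
  have hsup : F' = fun x => ⨆ N, truncation F' N x := (funext (iSup_truncation F')).symm
  rw [hsup, weightedNorm_iSup (monotone_truncation F')]
  refine iSup_le fun N => ?_
  by_contra! hlt
  -- Dividing the truncation by a b strictly between B and its norm puts it outside the unit ball.
  obtain ⟨b, hBb, hb⟩ := ENNReal.lt_iff_exists_nnreal_btwn.1 hlt
  have hb0 : b ≠ 0 := fun hc => by simp [hc] at hBb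
  have hb0' : (b : ℝ≥0∞) ≠ 0 := by simpa using hb0
  let E : Set (Fin n → ℝ) := Metric.ball 0 N
  have hE : MeasurableSet E := measurableSet_ball
  have : IsFiniteMeasure (μ.restrict E) := ⟨by simpa using hfin N⟩
  obtain ⟨J, T, hJ, hT⟩ := exists_measurePreserving_halfLine (μ.restrict E)
  have hρ := isFatouNorm_comp X.rep hJ hT
  let f : (Fin n → ℝ) → ℝ≥0 := fun x => b⁻¹ * (truncation F' N x).toNNReal
  have hfm : Measurable f := (measurable_truncation hF'm N).ennreal_toNNReal.const_mul _
  have hfc : ∀ x, (f x : ℝ≥0∞) = (b⁻¹ : ℝ≥0) * truncation F' N x := fun x => by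
    simp only [f, ENNReal.coe_mul, ENNReal.coe_toNNReal (truncation_ne_top F' N x)]
  have hfE : E.indicator (fun x => (f x : ℝ≥0∞)) = fun x => (b⁻¹ : ℝ≥0) * truncation F' N x := by
    ext x
    by_cases hx : x ∈ E
    · rw [Set.indicator_of_mem hx, hfc]
    · rw [Set.indicator_of_notMem hx, truncation, Set.indicator_of_notMem hx, mul_zero]
  have hf1 : 1 < X.rep.norm (J.indicator fun t => (f (T t) : ℝ≥0∞)) := by
    rw [← weightedNorm_indicator_eq hX hE hJ hT (s := fun x => (f x : ℝ≥0∞)) (by fun_prop), hfE,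
      weightedNorm_smul (inv_ne_zero hb0), ENNReal.coe_inv hb0,
      ← ENNReal.inv_mul_cancel hb0' ENNReal.coe_ne_top]
    exact (ENNReal.mul_lt_mul_iff_right (ENNReal.inv_ne_zero.2 ENNReal.coe_ne_top)
      (ENNReal.inv_ne_top.2 hb0')).2 hb
  obtain ⟨k, hk, hk1, hk2⟩ := hρ.exists_separating hfm (N := b⁻¹ * N) (fun x => by
    simp only [f]
    gcongr
    rw [← ENNReal.coe_le_coe, ENNReal.coe_toNNReal (truncation_ne_top F' N x)]
    exact_mod_cast truncation_le_natCast F' N x) hf1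
  -- Only the part of a test function on E matters, and cutting down to E does not increase its
  -- norm.
  have hk' : weightedAssociateNorm X v (E.indicator k) ≤ 1 := by
    refine weightedAssociateNorm_le fun g hg hg1 => ?_
    have h1 : ∀ x, E.indicator k x * g x = E.indicator (fun x => g x * k x) x := fun x => by
      by_cases hx : x ∈ E <;> simp [hx, mul_comm]
    rw [lintegral_congr h1, lintegral_indicator hE]
    refine hk2 g hg.restrict (le_trans ?_ hg1)
    rw [← weightedNorm_indicator_eq hX hE hJ hT hg.restrict]
    exact weightedNorm_mono (Filter.Eventually.of_forall fun x =>
      Set.indicator_le_self' (fun _ _ => zero_le) x)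
  have hfinal := h _ (hk.indicator hE) hk'
  refine absurd hfinal (not_le.2 (hBb.trans_le ?_))
  calc (b : ℝ≥0∞) ≤ b * ∫⁻ x in E, f x * k x ∂μ := le_mul_of_one_le_right zero_le hk1.le
    _ = ∫⁻ x in E, b * (f x * k x) ∂μ := (lintegral_const_mul' _ _ ENNReal.coe_ne_top).symm
    _ ≤ ∫⁻ x in E, F' x * k x ∂μ := by
        refine lintegral_mono fun x => ?_
        rw [hfc, ← mul_assoc, ← mul_assoc, ENNReal.coe_inv hb0,
          ENNReal.mul_inv_cancel hb0' ENNReal.coe_ne_top, one_mul]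
        gcongr
        exact truncation_le F' N x
    _ = ∫⁻ x, F x * E.indicator k x ∂μ := by
        rw [← lintegral_indicator hE]
        refine lintegral_congr_ae ?_
        filter_upwards [hFF'] with x hx
        by_cases hxE : x ∈ E <;> simp [hxE, hx]

end WeightedDuality

/-! ### Products of `A₁` weights -/

section Muckenhoupt

variable {n : ℕ} {w w₁ u v H : (Fin n → ℝ) → ℝ≥0∞}

/-- Every average of `w` over a cube is at most `C` times `w` at almost every point of the cube. -/
def IsAOneBound (w : (Fin n → ℝ) → ℝ≥0∞) (C : ℝ≥0∞) : Prop :=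
  ∀ᵐ x, ∀ (c : Fin n → ℝ) (r : ℝ), 0 < r → x ∈ Metric.ball c r →
    ⨍⁻ y in Metric.ball c r, w y ∂volume ≤ C * w x

theorem IsAOneBound.apConst_one_le {C : ℝ≥0∞} (h : IsAOneBound w C) : ApConst 1 w ≤ C :=
  WeightedRI.apConst_one_le (by filter_upwards [h] with x hx using maximal_le hx)

theorem MemAp.isAOneBound (hw : MemAp 1 w) : IsAOneBound w (ApConst 1 w) := hw.ae_laverage_le

theorem exists_mem_ball_of_ae {p : (Fin n → ℝ) → Prop} (h : ∀ᵐ x, p x) (c : Fin n → ℝ) {r : ℝ}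
    (hr : 0 < r) : ∃ x ∈ Metric.ball c r, p x := by
  by_contra! hc
  refine (volume_ball_pos c hr).ne' (measure_mono_null (fun x hx => ?_) (ae_iff.1 h))
  exact hc x hx

theorem IsAOneBound.laverage_lt_top {C : ℝ≥0∞} (h : IsAOneBound w C) (hw : IsWeight w)
    (hC : C ≠ ∞) (c : Fin n → ℝ) {r : ℝ} (hr : 0 < r) :
    ⨍⁻ y in Metric.ball c r, w y ∂volume < ∞ := by
  obtain ⟨x, hx, h1, h2⟩ := exists_mem_ball_of_ae (h.and hw.2) c hr
  exact (h1 c r hr hx).trans_lt (ENNReal.mul_lt_top hC.lt_top h2.2)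

theorem laverage_mul_le {f g : (Fin n → ℝ) → ℝ≥0∞} {a : ℝ≥0∞} (ha : a ≠ ∞) {c : Fin n → ℝ} {r : ℝ}
    (h : ∀ᵐ x ∂volume.restrict (Metric.ball c r), f x ≤ a * g x) :
    ⨍⁻ y in Metric.ball c r, f y ∂volume ≤ a * ⨍⁻ y in Metric.ball c r, g y ∂volume := by
  rw [setLAverage_eq, setLAverage_eq, ← mul_div_assoc, ← lintegral_const_mul' _ _ ha]
  exact ENNReal.div_le_div_right (lintegral_mono_ae h) _

/-- Average the A₁ inequality over one cube. Lower bounds of this kind are needed because Ψ is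
monotone only on [1, ∞). -/
theorem one_le_apConst_one (hw : MemAp 1 w) : 1 ≤ ApConst 1 w := by
  set a := ⨍⁻ y in Metric.ball (0 : Fin n → ℝ) 1, w y ∂volume with ha
  have ha0 : a ≠ 0 := (hw.1.laverage_pos 0 one_pos).ne'
  have hatop : a ≠ ∞ := (hw.isAOneBound.laverage_lt_top hw.1 hw.2.ne 0 one_pos).ne
  have h : ⨍⁻ _ in Metric.ball (0 : Fin n → ℝ) 1, a ∂volume ≤ ApConst 1 w * a := by
    refine laverage_mul_le hw.2.ne ?_
    filter_upwards [ae_restrict_of_ae hw.ae_laverage_le, ae_restrict_mem measurableSet_ball]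
      with x hx hxc using hx _ _ one_pos hxc
  rw [setLAverage_const (volume_ball_pos 0 one_pos).ne' measure_ball_lt_top.ne] at h
  nth_rewrite 1 [← one_mul a] at h
  exact (ENNReal.mul_le_mul_iff_left ha0 hatop).1 h

theorem apConst_of_one_lt {p : ℝ} (hp : 1 < p) (w : (Fin n → ℝ) → ℝ≥0∞) :
    ApConst p w = ⨆ (c : Fin n → ℝ) (r : ℝ) (_ : 0 < r),
      (⨍⁻ y in Metric.ball c r, w y ∂volume) *
        (⨍⁻ y in Metric.ball c r, w y ^ (1 - p.conjExponent) ∂volume) ^ (p - 1) :=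
  if_neg hp.ne'

/-- Hölder's inequality for 1 = w^(1/p) · w^(-1/p), raised to the power p. -/
theorem one_le_lintegral_mul_lintegral_rpow {α : Type*} [MeasurableSpace α] {P : Measure α}
    [IsProbabilityMeasure P] {p : ℝ} (hp : 1 < p) {w : α → ℝ≥0∞} (hwm : AEMeasurable w P)
    (hw : ∀ᵐ x ∂P, 0 < w x ∧ w x < ∞) :
    1 ≤ (∫⁻ x, w x ∂P) * (∫⁻ x, w x ^ (1 - p.conjExponent) ∂P) ^ (p - 1) := by
  have hpq := Real.HolderConjugate.conjExponent hp
  set q := p.conjExponent with hq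
  have hp0 : 0 < p := by linarith
  have hq0 : 0 < q := hpq.symm.pos
  have hH := ENNReal.lintegral_mul_le_Lp_mul_Lq P hpq (hwm.pow_const (1 / p))
    (hwm.pow_const (-(1 / p)))
  have h1 : ∫⁻ a, ((fun x => w x ^ (1 / p)) * fun x => w x ^ (-(1 / p))) a ∂P = 1 := by
    have : ∫⁻ _, 1 ∂P = 1 := by simp
    rw [← this]
    refine lintegral_congr_ae ?_
    filter_upwards [hw] with x hx
    rw [Pi.mul_apply, ← ENNReal.rpow_add _ _ hx.1.ne' hx.2.ne, add_neg_cancel, ENNReal.rpow_zero]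
  have hexp : -(1 / p) * q = 1 - q := by
    have h2 : q * (p⁻¹ + q⁻¹) = q := by rw [hpq.inv_add_inv_eq_one, mul_one]
    rw [mul_add, mul_inv_cancel₀ hq0.ne'] at h2
    rw [one_div]; linarith
  rw [h1] at hH
  simp only [← ENNReal.rpow_mul, hexp, one_div_mul_cancel hp0.ne', ENNReal.rpow_one] at hH
  have hpow := ENNReal.rpow_le_rpow hH hp0.le
  have hexp2 : 1 / q * p = p - 1 := by
    rw [one_div_mul_eq_div, div_eq_iff hq0.ne']
    exact hpq.sub_one_mul_conj.symm
  rwa [ENNReal.one_rpow, ENNReal.mul_rpow_of_nonneg _ _ hp0.le, ← ENNReal.rpow_mul,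
    ← ENNReal.rpow_mul, one_div_mul_cancel hp0.ne', ENNReal.rpow_one, hexp2] at hpow

theorem one_le_apConst_of_one_lt {p : ℝ} (hp : 1 < p) (hw : IsWeight w) : 1 ≤ ApConst p w := by
  rw [apConst_of_one_lt hp]
  refine le_iSup_of_le 0 (le_iSup_of_le 1 (le_iSup_of_le one_pos ?_))
  let ν : Measure (Fin n → ℝ) := volume.restrict (Metric.ball 0 1)
  have hν : ν Set.univ = volume (Metric.ball (0 : Fin n → ℝ) 1) := Measure.restrict_apply_univ _
  have hP : IsProbabilityMeasure ((ν Set.univ)⁻¹ • ν) := ⟨by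
    rw [Measure.smul_apply, smul_eq_mul, hν]
    exact ENNReal.inv_mul_cancel (volume_ball_pos 0 one_pos).ne' measure_ball_lt_top.ne⟩
  have hac : (ν Set.univ)⁻¹ • ν ≪ volume :=
    Measure.smul_absolutelyContinuous.trans Measure.restrict_le_self.absolutelyContinuous
  exact one_le_lintegral_mul_lintegral_rpow hp (hw.1.mono_ac hac) (hac hw.2)

theorem one_le_apConst {p : ℝ} (hp : 1 ≤ p) (hw : MemAp p w) : 1 ≤ ApConst p w := by
  rcases hp.eq_or_lt with rfl | hp
  · exact one_le_apConst_one hw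
  · exact one_le_apConst_of_one_lt hp hw.1

theorem IsWeight.mul (h₁ : IsWeight w₁) (h₂ : IsWeight u) : IsWeight fun x => w₁ x * u x := by
  refine ⟨h₁.1.mul h₂.1, ?_⟩
  filter_upwards [h₁.2, h₂.2] with x hx hy
  exact ⟨ENNReal.mul_pos hx.1.ne' hy.1.ne', ENNReal.mul_lt_top hx.2 hy.2⟩

/-- The easy half of the factorisation of `A_p` weights. -/
theorem apConst_mul_le {p : ℝ} (hp : 1 < p) {C₁ C₂ : ℝ≥0∞} (hC₁ : C₁ ≠ ∞) (hC₂ : C₂ ≠ ∞)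
    (hw₁ : IsWeight w₁) (hu : IsWeight u) (hu' : IsWeight fun x => u x ^ (1 - p.conjExponent))
    (h₁ : IsAOneBound w₁ C₁) (h₂ : IsAOneBound (fun x => u x ^ (1 - p.conjExponent)) C₂) :
    ApConst p (fun x => w₁ x * u x) ≤ C₁ * C₂ ^ (p - 1) := by
  have hpq := Real.HolderConjugate.conjExponent hp
  rw [apConst_of_one_lt hp]
  set s := p.conjExponent - 1 with hs
  have hexp : 1 - p.conjExponent = -s := by rw [hs]; ring
  have hp1 : 0 < p - 1 := by linarith
  have hs0 : 0 < s := by rw [hs]; linarith [hpq.symm.lt]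
  have hsp : s * (p - 1) = 1 := by
    have := hpq.sub_one_mul_conj
    rw [hs]; linarith
  rw [hexp] at hu' h₂ ⊢
  refine iSup_le fun c => iSup_le fun r => iSup_le fun hr => ?_
  set a := ⨍⁻ y in Metric.ball c r, w₁ y ∂volume with ha
  set b := ⨍⁻ y in Metric.ball c r, u y ^ (-s) ∂volume with hb
  have ha0 : a ≠ 0 := (hw₁.laverage_pos c hr).ne'
  have hatop : a ≠ ∞ := (h₁.laverage_lt_top hw₁ hC₁ c hr).ne
  have hb0 : b ≠ 0 := (hu'.laverage_pos c hr).ne'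
  have hbtop : b ≠ ∞ := (h₂.laverage_lt_top hu' hC₂ c hr).ne
  -- On the cube, the A₁ bound for u^(-s) reads b ≤ C₂ u^(-s). As s (p - 1) = 1, this bounds u above
  -- by a constant.
  have hA : ⨍⁻ y in Metric.ball c r, w₁ y * u y ∂volume ≤ (C₂ / b) ^ (p - 1) * a := by
    refine laverage_mul_le (ENNReal.rpow_ne_top_of_nonneg hp1.le (ENNReal.div_ne_top hC₂ hb0)) ?_
    filter_upwards [ae_restrict_of_ae h₂, ae_restrict_of_ae hu.2,
      ae_restrict_mem measurableSet_ball] with x hx hux hxc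
    have h := hx c r hr hxc
    rw [← hb, ENNReal.rpow_neg, ← div_eq_mul_inv] at h
    have hus0 : u x ^ s ≠ 0 := (ENNReal.rpow_pos hux.1 hux.2.ne).ne'
    have hustop : u x ^ s ≠ ∞ := ENNReal.rpow_ne_top_of_nonneg hs0.le hux.2.ne
    have h3 : u x ^ s ≤ C₂ / b := by
      rw [ENNReal.le_div_iff_mul_le (Or.inl hb0) (Or.inl hbtop), mul_comm]
      exact (ENNReal.le_div_iff_mul_le (Or.inl hus0) (Or.inl hustop)).1 h
    have h4 := ENNReal.rpow_le_rpow h3 hp1.le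
    rw [← ENNReal.rpow_mul, hsp, ENNReal.rpow_one] at h4
    rw [mul_comm]
    gcongr
  -- Symmetrically, a ≤ C₁ w₁ bounds w₁^(-s) above by a constant. In the product of both estimates
  -- the averages a and b cancel.
  have hB : ⨍⁻ y in Metric.ball c r, (w₁ y * u y) ^ (-s) ∂volume ≤ (C₁ / a) ^ s * b := by
    refine laverage_mul_le (ENNReal.rpow_ne_top_of_nonneg hs0.le (ENNReal.div_ne_top hC₁ ha0)) ?_
    filter_upwards [ae_restrict_of_ae h₁, ae_restrict_of_ae hu.2, ae_restrict_of_ae hw₁.2,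
      ae_restrict_mem measurableSet_ball] with x hx hux hwx hxc
    have h := hx c r hr hxc
    rw [ENNReal.mul_rpow_of_ne_top hwx.2.ne hux.2.ne]
    gcongr
    rw [ENNReal.rpow_neg, ← ENNReal.inv_rpow]
    gcongr
    rw [ENNReal.le_div_iff_mul_le (Or.inl ha0) (Or.inl hatop), mul_comm, ← div_eq_mul_inv]
    exact ENNReal.div_le_of_le_mul h
  calc _ ≤ ((C₂ / b) ^ (p - 1) * a) * ((C₁ / a) ^ s * b) ^ (p - 1) := by gcongr
    _ = (C₁ / a * a) * ((C₂ / b) * b) ^ (p - 1) := by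
      rw [ENNReal.mul_rpow_of_nonneg _ _ hp1.le, ENNReal.mul_rpow_of_nonneg _ _ hp1.le,
        ← ENNReal.rpow_mul, hsp, ENNReal.rpow_one]
      ring
    _ = _ := by rw [ENNReal.div_mul_cancel ha0 hatop, ENNReal.div_mul_cancel hb0 hbtop]

/-- If `H` is an `A₁` weight with respect to `v dx` and `v` is in `A₁`, then so is `H v`. -/
theorem isAOneBound_mul (hv : MemAp 1 v) {D : ℝ≥0}
    (hμ : DoublingOnCubes (volume.withDensity v) D) {C : ℝ≥0∞} (hH : AEMeasurable H volume)
    (h : ∀ x, maximal (volume.withDensity v) H x ≤ C * H x) :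
    IsAOneBound (fun x => H x * v x) (C * ApConst 1 v) := by
  filter_upwards [hv.ae_laverage_le] with x hx c r hr hxc
  have h1 : ∫⁻ y in Metric.ball c r, H y * v y =
      ∫⁻ y in Metric.ball c r, H y ∂volume.withDensity v := by
    rw [setLIntegral_withDensity_eq_lintegral_mul₀ hv.1.1 hH measurableSet_ball]
    exact lintegral_congr fun y => mul_comm _ _
  have h2 : ∫⁻ y in Metric.ball c r, v y = volume.withDensity v (Metric.ball c r) :=
    (withDensity_apply _ measurableSet_ball).symm
  -- The Lebesgue average of H v factors as the μ-average of H times the Lebesgue average of v.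
  calc ⨍⁻ y in Metric.ball c r, H y * v y ∂volume
      = (⨍⁻ y in Metric.ball c r, H y ∂volume.withDensity v) *
          ⨍⁻ y in Metric.ball c r, v y ∂volume := by
        rw [setLAverage_eq, setLAverage_eq, setLAverage_eq, h1, h2, ← mul_div_assoc,
          ENNReal.div_mul_cancel (hμ.pos c r hr).ne' (hμ.lt_top c r).ne]
    _ ≤ (C * H x) * (ApConst 1 v * v x) := by
        gcongr
        · exact (laverage_le_maximal H hr hxc).trans (h x)
        · exact hx c r hr hxc
    _ = _ := by ring

end Muckenhoupt

/-! ### The Rubio de Francia iteration -/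

section RubioDeFrancia

variable {n : ℕ}

/-- The Rubio de Francia iteration `∑ₖ aᵏ Mᵏ h`. -/
noncomputable def rubioDeFrancia (μ : Measure (Fin n → ℝ)) (a : ℝ≥0) (h : (Fin n → ℝ) → ℝ≥0∞)
    (x : Fin n → ℝ) : ℝ≥0∞ :=
  ∑' k : ℕ, (a : ℝ≥0∞) ^ k * (maximal μ)^[k] h x

variable {μ : Measure (Fin n → ℝ)} {a : ℝ≥0} {h : (Fin n → ℝ) → ℝ≥0∞}

theorem measurable_iterate_maximal (hh : Measurable h) (k : ℕ) :
    Measurable ((maximal μ)^[k] h) := by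
  cases k with
  | zero => exact hh
  | succ k => rw [Function.iterate_succ_apply']; exact measurable_maximal _ _

theorem measurable_rubioDeFrancia (hh : Measurable h) : Measurable (rubioDeFrancia μ a h) :=
  Measurable.tsum fun k => (measurable_iterate_maximal hh k).const_mul _

theorem le_rubioDeFrancia (x : Fin n → ℝ) : h x ≤ rubioDeFrancia μ a h x := by
  have := ENNReal.le_tsum (f := fun k : ℕ => (a : ℝ≥0∞) ^ k * (maximal μ)^[k] h x) 0
  simpa [rubioDeFrancia] using this

/-- The term k = 1 makes the series positive everywhere, even where h vanishes. -/
theorem mul_maximal_le_rubioDeFrancia (x : Fin n → ℝ) :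
    a * maximal μ h x ≤ rubioDeFrancia μ a h x := by
  have := ENNReal.le_tsum (f := fun k : ℕ => (a : ℝ≥0∞) ^ k * (maximal μ)^[k] h x) 1
  simpa [rubioDeFrancia] using this

/-- By sublinearity the maximal operator shifts the series by one index, at the price of a factor
1/a. -/
theorem maximal_rubioDeFrancia_le (ha : a ≠ 0) (hh : Measurable h) (x : Fin n → ℝ) :
    maximal μ (rubioDeFrancia μ a h) x ≤ (a : ℝ≥0∞)⁻¹ * rubioDeFrancia μ a h x := by
  have ha0 : (a : ℝ≥0∞) ≠ 0 := by simpa using ha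
  refine (maximal_tsum_le (f := fun k x => (a : ℝ≥0∞) ^ k * (maximal μ)^[k] h x)
    (fun k => ((measurable_iterate_maximal hh k).const_mul _).aemeasurable) x).trans ?_
  have h1 : ∀ k : ℕ, maximal μ (fun x => (a : ℝ≥0∞) ^ k * (maximal μ)^[k] h x) x =
      (a : ℝ≥0∞)⁻¹ * ((a : ℝ≥0∞) ^ (k + 1) * (maximal μ)^[k + 1] h x) := fun k => by
    rw [maximal_const_mul (pow_ne_zero _ ha0) (by simp), Function.iterate_succ_apply', pow_succ',
      ← mul_assoc, ← mul_assoc, ENNReal.inv_mul_cancel ha0 ENNReal.coe_ne_top, one_mul]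
  simp only [h1]
  rw [ENNReal.tsum_mul_left]
  gcongr
  exact ENNReal.tsum_comp_le_tsum_of_injective (add_left_injective 1)
    (fun k : ℕ => (a : ℝ≥0∞) ^ k * (maximal μ)^[k] h x)

variable [NeZero n] {X : BanachFunctionNorm (volume : Measure (Fin n → ℝ))}
  {v : (Fin n → ℝ) → ℝ≥0∞}

theorem weightedAssociateNorm_maximal_le (hA : maximalOpNorm X v ≠ ∞) (hh : AEMeasurable h volume)
    (htop : weightedAssociateNorm X v h ≠ ∞) :
    weightedAssociateNorm X v (maximal (volume.withDensity v) h) ≤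
      maximalOpNorm X v * weightedAssociateNorm X v h := by
  refine le_mul_of_forall_smul_le hA htop fun c hc hc1 => ?_
  rw [← weightedAssociateNorm_const_mul] at hc1 ⊢
  have hMc : (fun x => c * maximal (volume.withDensity v) h x) =
      maximal (volume.withDensity v) fun x => c * h x :=
    funext fun x => (maximal_const_mul (by simpa using hc) ENNReal.coe_ne_top x).symm
  rw [hMc]
  exact le_iSup_of_le (f := fun h : (Fin n → ℝ) → ℝ≥0∞ =>
      ⨆ (_ : AEMeasurable h volume) (_ : weightedAssociateNorm X v h ≤ 1),
        weightedAssociateNorm X v (maximal (volume.withDensity v) h)) (fun x => c * h x)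
    (le_iSup_of_le (hh.const_mul _) (le_iSup_of_le hc1 le_rfl))

/-- With a = 1/(2A) the k-th term has norm at most 2⁻ᵏ. -/
theorem weightedAssociateNorm_rubioDeFrancia_le (hA0 : maximalOpNorm X v ≠ 0)
    (hA : maximalOpNorm X v ≠ ∞) (hh : Measurable h) (h1 : weightedAssociateNorm X v h ≤ 1) :
    weightedAssociateNorm X v
      (rubioDeFrancia (volume.withDensity v) (2 * maximalOpNorm X v)⁻¹.toNNReal h) ≤ 2 := by
  set A := maximalOpNorm X v with hAdef
  set μ := volume.withDensity v with hμ
  have ha : (((2 * A)⁻¹.toNNReal : ℝ≥0) : ℝ≥0∞) = (2 * A)⁻¹ :=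
    ENNReal.coe_toNNReal (ENNReal.inv_ne_top.2 (mul_ne_zero two_ne_zero hA0))
  set a := (2 * A)⁻¹.toNNReal
  have hit : ∀ k : ℕ, weightedAssociateNorm X v ((maximal μ)^[k] h) ≤ A ^ k := by
    intro k
    induction k with
    | zero => simpa using h1
    | succ k ih =>
      rw [Function.iterate_succ_apply', pow_succ']
      exact (weightedAssociateNorm_maximal_le hA (measurable_iterate_maximal hh k).aemeasurable
        (ne_top_of_le_ne_top (by simp [hA]) ih)).trans (by gcongr)
  have haA : (a : ℝ≥0∞) * A = 2⁻¹ := by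
    rw [ha, ENNReal.mul_inv (by simp) (by simp), mul_assoc, ENNReal.inv_mul_cancel hA0 hA, mul_one]
  refine (weightedAssociateNorm_tsum_le
    (f := fun k x => (a : ℝ≥0∞) ^ k * (maximal μ)^[k] h x)
    fun k => ((measurable_iterate_maximal hh k).const_mul _).aemeasurable).trans ?_
  calc _ ≤ ∑' k : ℕ, (2⁻¹ : ℝ≥0∞) ^ k := by
        refine ENNReal.tsum_le_tsum fun k => ?_
        have := weightedAssociateNorm_const_mul (X := X) (v := v) (a ^ k) ((maximal μ)^[k] h)
        rw [ENNReal.coe_pow] at this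
        rw [this, ← haA, mul_pow]
        gcongr
        exact hit k
    _ = 2 := by rw [ENNReal.tsum_geometric, ENNReal.one_sub_inv_two, inv_inv]

end RubioDeFrancia

/-! ### Ingredients of the extrapolation argument -/

section Extrapolation

/-- The weight `H v u` built from an `A₁(v)` weight `H` and the weights `v`, `u` of the
extrapolation theorem. -/
theorem memAp_mul_mul {n : ℕ} {p : ℝ} {H u v : (Fin n → ℝ) → ℝ≥0∞} {C : ℝ≥0∞} (hC : C ≠ ∞)
    (hu : (p = 1 ∧ u = fun _ => 1) ∨
      (1 < p ∧ IsWeight u ∧ MemAp 1 fun x => u x ^ (1 - p.conjExponent)))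
    (hw : IsWeight fun x => H x * v x) (hb : IsAOneBound (fun x => H x * v x) C) :
    MemAp p (fun x => H x * v x * u x) ∧
      ApConst p (fun x => H x * v x * u x) ≤
        C * ApConst 1 (fun x => u x ^ (1 - p.conjExponent)) ^ (p - 1) := by
  rcases hu with ⟨rfl, rfl⟩ | ⟨hp, hu, hu'⟩
  · simp only [mul_one, sub_self, ENNReal.rpow_zero]
    have := hb.apConst_one_le
    exact ⟨⟨hw, this.trans_lt hC.lt_top⟩, this⟩
  · have := apConst_mul_le hp hC hu'.2.ne hw hu hu'.1 hb hu'.isAOneBound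
    exact ⟨⟨hw.mul hu, this.trans_lt (ENNReal.mul_lt_top hC.lt_top
      (ENNReal.rpow_lt_top_of_nonneg (by linarith) hu'.2.ne))⟩, this⟩

variable {n : ℕ} [NeZero n] {X : BanachFunctionNorm (volume : Measure (Fin n → ℝ))}
  {v h : (Fin n → ℝ) → ℝ≥0∞}

/-- Indicators of balls lie in X_v, so Hölder makes h integrable on balls for μ; positivity of v
transfers null sets back to Lebesgue measure. -/
theorem ae_lt_top_of_weightedAssociateNorm_ne_top {D : ℝ≥0} (hv : IsWeight v)
    (hμ : DoublingOnCubes (volume.withDensity v) D) (hh : Measurable h)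
    (htop : weightedAssociateNorm X v h ≠ ∞) : ∀ᵐ x, h x < ∞ := by
  set μ := volume.withDensity v
  have hball : ∀ N : ℕ, ∀ᵐ x ∂μ.restrict (Metric.ball (0 : Fin n → ℝ) N), h x < ∞ := by
    intro N
    have h1 := (weightedNorm_indicator_lt_top (X := X) (hμ.lt_top 0 N)).ne
    have h2 := lintegral_mul_le_weightedAssociateNorm_mul h
      (measurable_const.indicator measurableSet_ball).aemeasurable h1
    refine ae_lt_top hh (ne_top_of_le_ne_top (ENNReal.mul_ne_top htop h1) (le_trans ?_ h2))
    rw [← lintegral_indicator measurableSet_ball]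
    refine lintegral_mono fun x => ?_
    by_cases hx : x ∈ Metric.ball (0 : Fin n → ℝ) N <;> simp [hx]
  have hU := (ae_restrict_iUnion_iff _ _).2 hball
  rw [Metric.iUnion_ball_nat, Measure.restrict_univ] at hU
  exact withDensity_absolutelyContinuous' hv.1 (hv.2.mono fun x hx => hx.1.ne') hU

/-- The maximal function of h is positive everywhere, so it has nonzero integral over a cube and
nonzero associate norm. This makes 1/(2A) finite. -/
theorem maximalOpNorm_ne_zero {D : ℝ≥0} (hμ : DoublingOnCubes (volume.withDensity v) D)
    (hA : maximalOpNorm X v ≠ ∞) (hh : Measurable h) (h0 : ¬ h =ᵐ[volume.withDensity v] 0)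
    (htop : weightedAssociateNorm X v h ≠ ∞) : maximalOpNorm X v ≠ 0 := by
  intro hA0
  have hM := weightedAssociateNorm_maximal_le hA hh.aemeasurable htop
  set μ := volume.withDensity v
  rw [hA0, zero_mul] at hM
  have h2 := lintegral_mul_le_weightedAssociateNorm_mul (X := X) (maximal μ h)
    (measurable_const.indicator measurableSet_ball).aemeasurable
    (weightedNorm_indicator_lt_top (hμ.lt_top 0 1)).ne
  rw [nonpos_iff_eq_zero.1 hM, zero_mul, nonpos_iff_eq_zero] at h2
  have h3 := (lintegral_eq_zero_iff
    ((measurable_maximal μ h).mul (measurable_const.indicator measurableSet_ball))).1 h2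
  refine (hμ.pos 0 1 one_pos).ne' (measure_mono_null (fun x hx => ?_) (ae_iff.1 h3))
  have hM0 := (maximal_pos hμ hh.aemeasurable h0 x).ne'
  intro hc
  have hc' : maximal μ h x * (Metric.ball (0 : Fin n → ℝ) 1).indicator (fun _ => 1) x = 0 := hc
  rw [Set.indicator_of_mem hx, mul_one] at hc'
  exact hM0 hc'

end Extrapolation

end WeightedRI

/-! ### The extrapolation theorem -/

open WeightedRI
theorem theorem3p1 {n : ℕ} [NeZero n]
    (X : BanachFunctionNorm (volume : Measure (Fin n → ℝ))) (hX : X.IsRI)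
    (hq : upperBoydIndex X < ∞)
    (F : Set (((Fin n → ℝ) → ℝ≥0∞) × ((Fin n → ℝ) → ℝ≥0∞)))
    (hF : ∀ fg ∈ F, AEMeasurable fg.1 volume ∧ AEMeasurable fg.2 volume)
    (p₀ : ℝ) (hp₀ : 1 ≤ p₀)
    (Ψ : ℝ → ℝ) (hΨmono : MonotoneOn Ψ (Set.Ici 1)) (hΨ : ∀ t, 1 ≤ t → 1 ≤ Ψ t)
    (hyp : ∀ w, MemAp p₀ w → ∀ fg ∈ F,
      ∫⁻ x, fg.1 x * w x ≤ ENNReal.ofReal (Ψ (ApConst p₀ w).toReal) * ∫⁻ x, fg.2 x * w x)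
    (u : (Fin n → ℝ) → ℝ≥0∞)
    (hu : (p₀ = 1 ∧ u = fun _ => 1) ∨
      (1 < p₀ ∧ IsWeight u ∧ MemAp 1 fun x => u x ^ (1 - p₀.conjExponent)))
    (v : (Fin n → ℝ) → ℝ≥0∞) (hv : MemAp 1 v)
    (hvloc : ∀ K : Set (Fin n → ℝ), IsCompact K → ∫⁻ x in K, v x < ∞) :
    maximalOpNorm X v < ∞ ∧
    ∀ fg ∈ F,
      weightedNorm X v (fun x => fg.1 x * u x) ≤
        4 * ENNReal.ofReal (Ψ (2 * maximalOpNorm X v *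
            ApConst 1 (fun x => u x ^ (1 - p₀.conjExponent)) ^ (p₀ - 1) * ApConst 1 v).toReal) *
          weightedNorm X v (fun x => fg.2 x * u x) := by
  obtain ⟨D, hμ⟩ := exists_doublingOnCubes hv hvloc
  have hA := maximalOpNorm_lt_top hq hμ
  refine ⟨hA, ?_⟩
  rintro ⟨f, g⟩ hfg
  obtain ⟨hf, hg⟩ := hF _ hfg
  dsimp only at hf hg ⊢
  set A := maximalOpNorm X v with hAdef
  set μ := volume.withDensity v with hμdef
  have hac : μ ≪ volume := withDensity_absolutelyContinuous volume v
  have hum : AEMeasurable u volume := by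
    rcases hu with ⟨-, rfl⟩ | ⟨-, hu, -⟩
    · exact aemeasurable_const
    · exact hu.1
  set Cu := ApConst 1 (fun x => u x ^ (1 - p₀.conjExponent)) ^ (p₀ - 1) with hCu
  have hCutop : Cu ≠ ∞ := by
    rcases hu with ⟨rfl, -⟩ | ⟨-, -, hu⟩
    · simp [hCu]
    · exact ENNReal.rpow_ne_top_of_nonneg (by linarith) hu.2.ne
  have hKtop : 2 * A * Cu * ApConst 1 v ≠ ∞ := ENNReal.mul_ne_top
    (ENNReal.mul_ne_top (ENNReal.mul_ne_top ENNReal.ofNat_ne_top hA.ne) hCutop) hv.2.ne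
  refine weightedNorm_le_of_forall_lintegral_le hX (fun N => hμ.lt_top 0 N)
    ((hf.mul hum).mono_ac hac) fun h hh hh1 => ?_
  -- For h = 0 the series vanishes and is not a weight, so this case is separate.
  by_cases h0 : h =ᵐ[μ] 0
  · rw [lintegral_eq_zero_of_ae_eq_zero]
    · exact zero_le
    · filter_upwards [h0] with x hx
      simp [hx]
  have hA0 : A ≠ 0 := maximalOpNorm_ne_zero hμ hA.ne hh h0 (ne_top_of_le_ne_top (by simp) hh1)
  let a : ℝ≥0 := (2 * A)⁻¹.toNNReal
  have ha : (a : ℝ≥0∞) = (2 * A)⁻¹ :=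
    ENNReal.coe_toNNReal (ENNReal.inv_ne_top.2 (mul_ne_zero two_ne_zero hA0))
  have ha0 : a ≠ 0 := by
    rw [← ENNReal.coe_ne_zero, ha]
    exact ENNReal.inv_ne_zero.2 (ENNReal.mul_ne_top ENNReal.ofNat_ne_top hA.ne)
  let H := rubioDeFrancia μ a h
  have hHm : Measurable H := measurable_rubioDeFrancia hh
  have hH2 : weightedAssociateNorm X v H ≤ 2 :=
    weightedAssociateNorm_rubioDeFrancia_le hA0 hA.ne hh hh1
  have hHw : IsWeight H := by
    refine ⟨hHm.aemeasurable, ?_⟩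
    filter_upwards [ae_lt_top_of_weightedAssociateNorm_ne_top hv.1 hμ hHm
      (ne_top_of_le_ne_top ENNReal.ofNat_ne_top hH2)] with x hx
    exact ⟨(ENNReal.mul_pos (by simpa using ha0)
      (maximal_pos hμ hh.aemeasurable h0 x).ne').trans_le (mul_maximal_le_rubioDeFrancia x), hx⟩
  have hHmax : ∀ x, maximal μ H x ≤ 2 * A * H x := fun x => by
    have := maximal_rubioDeFrancia_le (μ := μ) ha0 hh x
    rwa [ha, inv_inv] at this
  obtain ⟨hw, hwle⟩ := memAp_mul_mul (ENNReal.mul_ne_top (ENNReal.mul_ne_top ENNReal.ofNat_ne_top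
    hA.ne) hv.2.ne) hu (hHw.mul hv.1) (isAOneBound_mul hv hμ hHm.aemeasurable hHmax)
  have hwle' : ApConst p₀ (fun x => H x * v x * u x) ≤ 2 * A * Cu * ApConst 1 v :=
    hwle.trans_eq (mul_right_comm _ _ _)
  have hreal : (ApConst p₀ fun x => H x * v x * u x).toReal ≤
      (2 * A * Cu * ApConst 1 v).toReal := ENNReal.toReal_mono hKtop hwle'
  -- Both arguments of Ψ must lie in [1, ∞) for its monotonicity to apply.
  have hone : 1 ≤ (ApConst p₀ fun x => H x * v x * u x).toReal := by
    simpa using ENNReal.toReal_mono hw.2.ne (one_le_apConst hp₀ hw)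
  have hΨle : ENNReal.ofReal (Ψ (ApConst p₀ fun x => H x * v x * u x).toReal) ≤
      ENNReal.ofReal (Ψ (2 * A * Cu * ApConst 1 v).toReal) :=
    ENNReal.ofReal_le_ofReal (hΨmono hone (hone.trans hreal) hreal)
  have hΨ1 : 1 ≤ ENNReal.ofReal (Ψ (2 * A * Cu * ApConst 1 v).toReal) := by
    simpa using hΨ _ (hone.trans hreal)
  have hchange : ∀ k : (Fin n → ℝ) → ℝ≥0∞, AEMeasurable k volume →
      ∫⁻ x, k x * (H x * v x * u x) = ∫⁻ x, H x * (k x * u x) ∂μ := fun k hk => by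
    refine Eq.trans ?_ (lintegral_withDensity_eq_lintegral_mul₀ hv.1.1
      (hHm.aemeasurable.mul (hk.mul hum))).symm
    refine lintegral_congr fun x => ?_
    simp only [Pi.mul_apply]
    ring
  set P := ENNReal.ofReal (Ψ (2 * A * Cu * ApConst 1 v).toReal)
  -- Hölder below requires a finite norm; if it is infinite, Ψ ≥ 1 makes the right-hand side
  -- infinite.
  rcases eq_or_ne (weightedNorm X v fun x => g x * u x) ∞ with hgtop | hgtop
  · rw [hgtop, ENNReal.mul_top (mul_ne_zero (by simp) (one_pos.trans_le hΨ1).ne')]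
    exact le_top
  calc ∫⁻ x, f x * u x * h x ∂μ ≤ ∫⁻ x, H x * (f x * u x) ∂μ := by
        refine lintegral_mono fun x => ?_
        rw [mul_comm]
        gcongr
        exact le_rubioDeFrancia x
    _ = ∫⁻ x, f x * (H x * v x * u x) := (hchange f hf).symm
    _ ≤ P * ∫⁻ x, g x * (H x * v x * u x) := (hyp _ hw _ hfg).trans (by gcongr)
    _ = P * ∫⁻ x, H x * (g x * u x) ∂μ := by rw [hchange g hg]
    _ ≤ P * (2 * weightedNorm X v fun x => g x * u x) := by
        gcongr
        exact (lintegral_mul_le_weightedAssociateNorm_mul H ((hg.mul hum).mono_ac hac)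
          hgtop).trans (mul_le_mul' hH2 le_rfl)
    _ = 2 * P * weightedNorm X v fun x => g x * u x := by ring
    -- The argument gives the constant 2, from ‖H‖ ≤ 2; the 4 of the statement leaves room.
    _ ≤ 4 * P * weightedNorm X v fun x => g x * u x := by
        gcongr
        norm_num
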